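/- Let $\mathbb K$ be a commutative ring. For a $\mathbb K$-module $V$ let $\mathscr F(V)=\bigoplus_{n\ge0}\mathscr F_n(V)$ with $\mathscr F_n(V)=V^{\otimes n}\#\mathbb K\mathfrak S_n$, the tensor product of $V^{\otimes n}$ and $\mathbb K\mathfrak S_n$ (with pure tensors written $t\#\sigma$), and let $\mathfrak S_n$ act on the left on $\mathscr F_n(V)$ by $\pi\cdot[(v_1\otimes\cdots\otimes v_n)\#\sigma]=(v_{\pi^{-1}(1)}\otimes\cdots\otimes v_{\pi^{-1}(n)})\#\pi\sigma$. The external product on $\mathscr F(V)$ is the bilinear product with $$(t\#\sigma)*(t'\#\sigma')=\sum_{\pi}\pi\cdot\bigl[(t\otimes t')\#(\sigma\times\sigma')\bigr]\qquad(t\in V^{\otimes n},\ \sigma\in\mathfrak S_n,\ t'\in V^{\otimes m},\ \sigma'\in\mathfrak S_m),$$ where $\pi$ runs over the permutations in $\mathfrak S_{n+m}$ that are increasing on $\{1,\dots,n\}$ and on $\{n+1,\dots,n+m\}$; its unit is $()\#e_0$. For a graded submodule $W=\bigoplus_n W_n$ of the tensor algebra $\mathrm T(V)=\bigoplus_nV^{\otimes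 n}$, the descent algebra $\Sigma(W)$ is the (unital) subalgebra of $(\mathscr F(V),*)$ generated by the elements $t\#e_n$ with $n\ge0$ and $t\in W_n$, where $e_n\in\mathfrak S_n$ is the identity. Let $\mathrm{TS}^n(V)\subseteq V^{\otimes n}$ be the module of symmetric tensors, and let $\mathrm{NT}(V)=\Sigma\bigl(\bigoplus_n\mathrm{TS}^n(V)\bigr)$. If $V$ is a coalgebra with iterated coproducts $\delta_n:V\to V^{\otimes n}$ ($\delta_0$ is the counit, $\delta_1=\mathrm{id}$), let $\mathrm{MR}(V)=\Sigma\bigl(\bigoplus_n\delta_n(V)\bigr)$. Let $A$ be an (associative, unital) $\mathbb K$-algebra whose underlying $\mathbb K$-module is projective. Then $\mathscr F_n(A)$ is the twisted group ring of $\mathfrak S_n$ over $A^{\otimes n}$, with the internal product $$[(a_1\otimes\cdots\otimes a_n)\#\sigma]\cdot[(b_1\otimes\cdots\otimes b_n)\#\tau]=(a_1b_{\sigma^{-1}(1)}\otimes\cdots\otimes a_nb_{\sigma^{-1}(n)})\#\sigma\tau$$ and the unit $1^{\otimes n}\#e_n$. A graded submodule $S$ of $\mathscr F(A)$ is called a subalgebra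 for the internal product if, for each $n$, $S\cap\mathscr F_n(A)$ is closed under the internal product of $\mathscr F_n(A)$. Let $B=\bigoplus_nB_n$ be a graded submodule of $\mathrm T(A)$ such that - (A) for each positive integer $n$ and each finite sequence $(c_1,\dots,c_k)$ of non-negative integers with sum $n$, $B_n$ is contained in the image of $B_{c_1}\otimes\cdots\otimes B_{c_k}$ in $A^{\otimes n}$; - (B) each $B_n$ is closed under the multiplication of $A^{\otimes n}$; - (C) $B_n\subseteq\mathrm{TS}^n(A)$ for each $n$. Then $\Sigma(B)$ is a subalgebra of $\mathscr F(A)$ for the internal product; moreover, for each $n$ such that $1^{\otimes n}\in B_n$, it contains the unit $1^{\otimes n}\#e_n$ of $\mathscr F_n(A)$. In particular, $\mathrm{NT}(A)$ is a subalgebra of $\mathscr F(A)$ for the internal product, and so is $\mathrm{MR}(A)$ when $A$ is moreover a cocommutative bialgebra; both contain the units $1^{\otimes n}\#e_n$ for all $n$. -/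

import Mathlib

open scoped TensorProduct DirectSum

noncomputable section

namespace FreeQSym

universe u v

section Module

variable (K : Type u) [CommRing K] (V : Type v) [AddCommGroup V] [Module K V]

/-- The left action of `𝔖ₙ` on `V^{⊗n}` by permutation of the factors,
`π • (v₁ ⊗ ⋯ ⊗ vₙ) = v_{π⁻¹(1)} ⊗ ⋯ ⊗ v_{π⁻¹(n)}`. -/
instance permAction (n : ℕ) : DistribMulAction (Equiv.Perm (Fin n)) (⨂[K]^n V) where
  smul π t := PiTensorProduct.reindex K (fun _ => V) π t
  one_smul t := by
    change PiTensorProduct.reindex K (fun _ => V) (Equiv.refl (Fin n)) t = t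
    rw [PiTensorProduct.reindex_refl]; rfl
  mul_smul π ρ t := (PiTensorProduct.reindex_reindex (R := K) (s := fun _ => V) ρ π t).symm
  smul_zero π := map_zero (PiTensorProduct.reindex K (fun _ => V) π)
  smul_add π := map_add (PiTensorProduct.reindex K (fun _ => V) π)

variable {K V}

theorem perm_smul_tprod {n : ℕ} (π : Equiv.Perm (Fin n)) (a : Fin n → V) :
    π • PiTensorProduct.tprod K a = PiTensorProduct.tprod K (fun i => a (π⁻¹ i)) :=
  PiTensorProduct.reindex_tprod (R := K) (s := fun _ => V) π a

variable (K V)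

/-- The action of a permutation on `V^{⊗n}`, as a linear map. -/
def permLin {n : ℕ} (π : Equiv.Perm (Fin n)) : ⨂[K]^n V →ₗ[K] ⨂[K]^n V :=
  (PiTensorProduct.reindex K (fun _ => V) π).toLinearMap

/-- The homogeneous component `𝓕ₙ(V) = V^{⊗n} # K𝔖ₙ`: formal sums of symbols `t # σ`, where
`t ∈ V^{⊗n}` and `σ ∈ 𝔖ₙ`. The symbol `t # σ` is `SkewMonoidAlgebra.single σ t`. When `V` is an
algebra, the multiplication of this type is that of the twisted group ring, i.e. the internal
product. -/
abbrev FComp (n : ℕ) : Type (max u v) := SkewMonoidAlgebra (⨂[K]^n V) (Equiv.Perm (Fin n))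

/-- The module `𝓕(V) = ⨁ₙ 𝓕ₙ(V)`. -/
abbrev F : Type (max u v) := ⨁ n : ℕ, FComp K V n

/-- The linear map `t ↦ t # σ`. -/
def sharp {n : ℕ} (σ : Equiv.Perm (Fin n)) : ⨂[K]^n V →ₗ[K] FComp K V n :=
  (SkewMonoidAlgebra.coeffLinearEquiv (S := K)).symm.toLinearMap ∘ₗ Finsupp.lsingle σ

variable {K V} in
theorem sharp_apply {n : ℕ} (σ : Equiv.Perm (Fin n)) (t : ⨂[K]^n V) :
    sharp K V σ t = SkewMonoidAlgebra.single σ t := rfl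

/-- The permutation `σ × σ' ∈ 𝔖ₙ × 𝔖ₘ ⊆ 𝔖ₙ₊ₘ`. -/
def permProd {n m : ℕ} (σ : Equiv.Perm (Fin n)) (σ' : Equiv.Perm (Fin m)) :
    Equiv.Perm (Fin (n + m)) :=
  finSumFinEquiv.permCongr (Equiv.Perm.sumCongr σ σ')

open Classical in
/-- The set `X_{(n,m)}` of the permutations of `n + m` letters that are increasing on the first
`n` letters and on the last `m` letters. -/
def shuffles (n m : ℕ) : Finset (Equiv.Perm (Fin (n + m))) :=
  Finset.univ.filter fun π =>
    StrictMono (fun i : Fin n => π (Fin.castAdd m i)) ∧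
      StrictMono (fun j : Fin m => π (Fin.natAdd n j))

/-- The bilinear map `(t, t') ↦ x_{(n,m)} · [(t ⊗ t') # (σ × σ')]`. -/
def extMulSharp {n m : ℕ} (σ : Equiv.Perm (Fin n)) (σ' : Equiv.Perm (Fin m)) :
    ⨂[K]^n V →ₗ[K] ⨂[K]^m V →ₗ[K] FComp K V (n + m) :=
  (TensorProduct.mk K (⨂[K]^n V) (⨂[K]^m V)).compr₂
    ((∑ π ∈ shuffles n m, sharp K V (π * permProd σ σ') ∘ₗ permLin K V π) ∘ₗ
      (TensorPower.mulEquiv (R := K) (M := V)).toLinearMap)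

/-- The external product `𝓕ₙ(V) × 𝓕ₘ(V) → 𝓕ₙ₊ₘ(V)`. -/
def extMulComp (n m : ℕ) : FComp K V n →ₗ[K] FComp K V m →ₗ[K] FComp K V (n + m) :=
  (Finsupp.lsum K fun σ =>
    ((Finsupp.lsum K fun σ' => (extMulSharp K V σ σ').flip) ∘ₗ
      (SkewMonoidAlgebra.coeffLinearEquiv (S := K)).toLinearMap).flip) ∘ₗ
    (SkewMonoidAlgebra.coeffLinearEquiv (S := K)).toLinearMap

variable {K V} in
theorem extMulComp_single_single {n m : ℕ} (σ : Equiv.Perm (Fin n)) (σ' : Equiv.Perm (Fin m))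
    (t : ⨂[K]^n V) (t' : ⨂[K]^m V) :
    extMulComp K V n m (SkewMonoidAlgebra.single σ t) (SkewMonoidAlgebra.single σ' t') =
      ∑ π ∈ shuffles n m, SkewMonoidAlgebra.single (π * permProd σ σ')
        (π • TensorPower.mulEquiv (t ⊗ₜ[K] t')) := by
  simp [extMulComp, extMulSharp, SkewMonoidAlgebra.coeffLinearEquiv, sharp_apply]
  rfl

/-- The external product `*` on `𝓕(V)`. -/
def extMul : F K V →ₗ[K] F K V →ₗ[K] F K V :=
  DirectSum.toModule K ℕ _ fun n =>
    (DirectSum.toModule K ℕ _ fun m =>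
      ((extMulComp K V n m).compr₂ (DirectSum.lof K ℕ (FComp K V) (n + m))).flip).flip

variable {K V} in
theorem extMul_lof_lof {n m : ℕ} (a : FComp K V n) (b : FComp K V m) :
    extMul K V (DirectSum.lof K ℕ (FComp K V) n a) (DirectSum.lof K ℕ (FComp K V) m b) =
      DirectSum.lof K ℕ (FComp K V) (n + m) (extMulComp K V n m a b) := by
  simp [extMul]

/-- The unit `() # e₀` of `𝓕(V)` for the external product. -/
def extOne : F K V :=
  DirectSum.lof K ℕ (FComp K V) 0
    (SkewMonoidAlgebra.single 1 (PiTensorProduct.tprod K Fin.elim0))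

variable {K V}

/-- The descent algebra `Σ(W)` of a graded submodule `W = ⨁ₙ Wₙ` of the tensor algebra, given by
its components `Wₙ ⊆ V^{⊗n}`: the subalgebra of `𝓕(V)` for the external product generated by the
elements `t # eₙ`, where `t ∈ Wₙ`. -/
def descentAlgebra (W : (n : ℕ) → Submodule K (⨂[K]^n V)) : Submodule K (F K V) :=
  sInf {S | extOne K V ∈ S ∧ (∀ x ∈ S, ∀ y ∈ S, extMul K V x y ∈ S) ∧
    ∀ n, ∀ t ∈ W n, DirectSum.lof K ℕ (FComp K V) n (SkewMonoidAlgebra.single 1 t) ∈ S}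

/-- The intersection `S ∩ 𝓕ₙ(V)`, as a submodule of `𝓕ₙ(V)`. -/
def component (S : Submodule K (F K V)) (n : ℕ) : Submodule K (FComp K V n) :=
  S.comap (DirectSum.lof K ℕ (FComp K V) n)

/-- Condition (A): `Wₙ ⊆ W_{c₁} ⊗ ⋯ ⊗ W_{cₖ}` for each composition `c = (c₁, …, cₖ)`, possibly with
parts equal to zero, of a positive integer `n`. Here `W_{c₁} ⊗ ⋯ ⊗ W_{cₖ}` stands for its image in
`V^{⊗n}`, which is the product of the submodules `W_{cᵢ}` in the tensor algebra `⨁ₙ V^{⊗n}`. -/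
def ConditionA (W : (n : ℕ) → Submodule K (⨂[K]^n V)) : Prop :=
  ∀ n : ℕ, 0 < n → ∀ c : List ℕ, c.sum = n →
    (W n).map (DirectSum.lof K ℕ (fun i : ℕ => ⨂[K]^i V) n) ≤
      (c.map fun m => (W m).map (DirectSum.lof K ℕ (fun i : ℕ => ⨂[K]^i V) m)).prod

variable (K V)

/-- The module `TSⁿ(V)` of symmetric tensors. -/
def symTensors (n : ℕ) : Submodule K (⨂[K]^n V) :=
  ⨅ π : Equiv.Perm (Fin n), LinearMap.eqLocus (permLin K V π) LinearMap.id

variable {K V} in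
theorem mem_symTensors {n : ℕ} {t : ⨂[K]^n V} :
    t ∈ symTensors K V n ↔ ∀ π : Equiv.Perm (Fin n), π • t = t := by
  simp only [symTensors, Submodule.mem_iInf, LinearMap.mem_eqLocus]
  rfl

variable {K V} in
/-- Condition (C): each `Wₙ` consists of symmetric tensors. -/
def ConditionC (W : (n : ℕ) → Submodule K (⨂[K]^n V)) : Prop :=
  ∀ n : ℕ, W n ≤ symTensors K V n

/-- The Novelli-Thibon bialgebra `NT(V) = Σ(TS(V))`. -/
def novelliThibon : Submodule K (F K V) := descentAlgebra (symTensors K V)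

end Module

section Coalgebra

variable (K : Type u) [CommRing K] (C : Type v) [AddCommGroup C] [Module K C] [Coalgebra K C]

/-- The iterated coproduct `δₙ : C → C^{⊗n}`, given by `δ₀ = ε` and `δₙ₊₁ = (δₙ ⊗ id) ∘ δ`. By the
counit law, `δ₁ = id`. -/
def iterComul : (n : ℕ) → C →ₗ[K] ⨂[K]^n C
  | 0 => (TensorPower.algebraMap₀ (R := K) (M := C)).toLinearMap ∘ₗ Coalgebra.counit
  | n + 1 => (TensorPower.mulEquiv (R := K) (M := C) (n := n) (m := 1)).toLinearMap ∘ₗ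
      TensorProduct.map (iterComul n)
        (PiTensorProduct.subsingletonEquiv (R := K) (s := fun _ => C) (0 : Fin 1)).symm.toLinearMap
      ∘ₗ Coalgebra.comul

/-- The Mantaci-Reutenauer bialgebra `MR(C) = Σ(W)`, where `Wₙ` is the image of `δₙ`. -/
def mantaciReutenauer : Submodule K (F K C) :=
  descentAlgebra fun n => LinearMap.range (iterComul K C n)

end Coalgebra

section Algebra

variable {K : Type u} [CommRing K] {A : Type v} [Ring A] [Algebra K A]

/-- `𝔖ₙ` acts on the algebra `A^{⊗n}` by automorphisms of algebra. This makes
`𝓕ₙ(A) = A^{⊗n} # K𝔖ₙ` the twisted group ring, with the internal product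
`(a # σ) * (b # τ) = (a (σ • b)) # (σ τ)` and the unit `1^{⊗n} # eₙ`. -/
instance permMulAction (n : ℕ) : MulSemiringAction (Equiv.Perm (Fin n)) (⨂[K]^n A) where
  __ := permAction K A n
  smul_one π := perm_smul_tprod π 1
  smul_mul π x y := by
    change permLin K A π (x * y) = permLin K A π x * permLin K A π y
    induction x using PiTensorProduct.induction_on with
    | add x x' hx hx' => simp only [add_mul, map_add, hx, hx']
    | smul_tprod r a =>
      induction y using PiTensorProduct.induction_on with
      | add y y' hy hy' => simp only [mul_add, map_add, hy, hy']
      | smul_tprod s b =>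
        simp only [PiTensorProduct.smul_tprod_mul_smul_tprod, map_smul, permLin,
          LinearEquiv.coe_coe, PiTensorProduct.reindex_tprod]
        rfl

theorem sharp_mul_sharp {n : ℕ} (σ τ : Equiv.Perm (Fin n)) (a b : ⨂[K]^n A) :
    (SkewMonoidAlgebra.single σ a * SkewMonoidAlgebra.single τ b : FComp K A n) =
      SkewMonoidAlgebra.single (σ * τ) (a * σ • b) :=
  SkewMonoidAlgebra.single_mul_single

/-- Condition (B): each `Bₙ` is a subalgebra of `A^{⊗n}`. It is not required to contain
`1^{⊗n}`. -/
def ConditionB (B : (n : ℕ) → Submodule K (⨂[K]^n A)) : Prop :=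
  ∀ n : ℕ, ∀ x ∈ B n, ∀ y ∈ B n, x * y ∈ B n

/-- `S` is a graded submodule of `𝓕(A)` and each `S ∩ 𝓕ₙ(A)` is a subalgebra of `𝓕ₙ(A)`, not
required to contain `1^{⊗n} # eₙ`. -/
structure IsInternalSubalgebra (S : Submodule K (F K A)) : Prop where
  graded : ∀ x ∈ S, ∀ n : ℕ, x n ∈ component S n
  mul_mem : ∀ n : ℕ, ∀ x ∈ component S n, ∀ y ∈ component S n, x * y ∈ component S n

end Algebra

end FreeQSym

end

noncomputable section

namespace FreeQSym

universe u v

/-! Encode a composition of `n`, possibly with zero parts, by a monotone word `w` on `n` positions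
whose letters are the indices of the parts. An iterated external product of generators is then the
sum of `π · (u # e)` over the permutations `π` increasing on the positions of each letter, where `u`
is a tensor with one factor in `B` for each letter (`extMulComp_wordSum`). These elements, `wordSum
w u`, span the components of `Σ(B)` (`component_descentAlgebra`), so it suffices to multiply two of
them.

The computation is a Mackey-type formula (`wordSum_mul_wordSum_mem`). In the product of `wordSum v
t` and `wordSum w s`, the pair `(π, ρ)` contributes `πρ · ((ρ⁻¹t · s) # e)`. By (C), `t` is fixed by
the Young subgroup of `v`, so `ρ⁻¹t` depends only on the word `v ∘ ρ`. Group the pairs by this word: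
within the class of `ρ₀`, `(π, ρ) ↦ πρ` is a bijection onto the shuffles for the pair of words `(w,
v ∘ ρ₀)` (`sum_fiberShuffles_mul`), and this pair, ordered lexicographically, is again monotone. By
(A), `ρ₀⁻¹t` and `s` both have their factors in `B` along this common refinement (`wordTensors_le`);
by (B), so has their product. Each class thus sums to one spanning element.

To compare tensors along non-contiguous blocks, a factor is inserted at its places in `A^{⊗n}`, with
`1` elsewhere; outer products become ordinary products of commuting elements. By (C), only the set
of places matters.

For `NT`, the splitting of symmetric tensors is proved with orbit sums on a free module and passed
to a projective module as a retract. For `MR`, coassociativity gives (A), multiplicativity of the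
coproduct gives (B), and cocommutativity gives (C). -/

/-! ### Shuffles of words and their composition -/

open Classical in
/-- The permutations that are increasing on each set of positions carrying the same letter of the
word `w`. -/
def fiberShuffles {n : ℕ} (w : Fin n → ℕ) : Finset (Equiv.Perm (Fin n)) :=
  Finset.univ.filter fun π => ∀ i j, i < j → w i = w j → π i < π j

theorem mem_fiberShuffles {n : ℕ} {w : Fin n → ℕ} {π : Equiv.Perm (Fin n)} :
    π ∈ fiberShuffles w ↔ ∀ i j, i < j → w i = w j → π i < π j := by
  simp [fiberShuffles]

theorem fiberShuffles_congr {n : ℕ} {w w' : Fin n → ℕ} (h : ∀ i j, w i = w j ↔ w' i = w' j) :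
    fiberShuffles w = fiberShuffles w' := by
  ext π
  simp only [mem_fiberShuffles, h]

theorem one_mem_fiberShuffles {n : ℕ} (w : Fin n → ℕ) : 1 ∈ fiberShuffles w :=
  mem_fiberShuffles.2 fun _ _ h _ => h

theorem fiberShuffles_const {n : ℕ} (c : ℕ) : fiberShuffles (fun _ : Fin n => c) = {1} := by
  ext π
  rw [Finset.mem_singleton, ← Equiv.Perm.monotone_iff, mem_fiberShuffles]
  exact ⟨fun h => StrictMono.monotone fun i j hij => h i j hij rfl,
    fun h i j hij _ => (h.strictMono_of_injective π.injective) hij⟩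

/-- A shuffle for a monotone word is a stable sorting permutation, hence is determined by the word
`f` that it sorts. This recovers the left factor of a product of shuffles. -/
theorem fiberShuffles_eq_sort {n : ℕ} {v : Fin n → ℕ} (hv : Monotone v) {π : Equiv.Perm (Fin n)}
    (hπ : π ∈ fiberShuffles v) {f : Fin n → ℕ} (hf : f ∘ π = v) : π = Tuple.sort f := by
  subst hf
  exact Tuple.eq_sort_iff.2 ⟨hv, fun i j => mem_fiberShuffles.1 hπ i j⟩

/-- The word that records the letters of `w` and the letters of `r`, where `r` takes values
less than `N`. -/
def pairWord {n : ℕ} (N : ℕ) (w r : Fin n → ℕ) : Fin n → ℕ := fun i => N * w i + r i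

theorem pairWord_div {n N : ℕ} {w r : Fin n → ℕ} (hr : ∀ i, r i < N) (i : Fin n) :
    pairWord N w r i / N = w i := by
  have hN : 0 < N := (Nat.zero_le _).trans_lt (hr i)
  simp [pairWord, Nat.mul_add_div hN, Nat.div_eq_of_lt (hr i)]

theorem pairWord_mod {n N : ℕ} {w r : Fin n → ℕ} (hr : ∀ i, r i < N) (i : Fin n) :
    pairWord N w r i % N = r i := by
  simp [pairWord, Nat.mod_eq_of_lt (hr i)]

theorem pairWord_eq_iff {n N : ℕ} {w r : Fin n → ℕ} (hr : ∀ i, r i < N) (i j : Fin n) :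
    pairWord N w r i = pairWord N w r j ↔ w i = w j ∧ r i = r j := by
  refine ⟨fun h => ?_, fun h => by simp [pairWord, h.1, h.2]⟩
  refine ⟨?_, ?_⟩
  · rw [← pairWord_div hr i (w := w), h, pairWord_div hr]
  · rw [← pairWord_mod hr i (w := w), h, pairWord_mod hr]

theorem pairWord_lt {n N M : ℕ} {w r : Fin n → ℕ} (hr : ∀ i, r i < N) (hw : ∀ i, w i < M)
    (i : Fin n) : pairWord N w r i < N * M := by
  have h1 := Nat.mul_le_mul_left N (Nat.succ_le_of_lt (hw i))
  have h2 := hr i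
  simp only [pairWord]
  rw [Nat.mul_succ] at h1
  omega

theorem pairWord_monotone {n N : ℕ} {v w : Fin n → ℕ} (hv : Monotone v) (hw : Monotone w)
    (hN : ∀ i, v i < N) {ρ : Equiv.Perm (Fin n)} (hρ : ρ ∈ fiberShuffles w) :
    Monotone (pairWord N w (v ∘ ρ)) := by
  intro i j hij
  rcases hij.eq_or_lt with rfl | hij
  · rfl
  simp only [pairWord, Function.comp]
  rcases (hw hij.le).eq_or_lt with h | h
  · have := hv (mem_fiberShuffles.1 hρ i j hij h).le
    rw [h]; omega
  · have h1 := Nat.mul_le_mul_left N (Nat.succ_le_of_lt h)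
    have h2 := hN (ρ i)
    rw [Nat.mul_succ] at h1
    omega

open Classical in
/-- Composition of shuffles: for a monotone word `v` and `ρ₀` a shuffle for `w`, the map
`(π, ρ) ↦ π ρ` is a bijection from the pairs of shuffles for `v` and `w` with `v ∘ ρ = v ∘ ρ₀` onto
the shuffles for the pair of words `(w, v ∘ ρ₀)`. -/
theorem sum_fiberShuffles_mul {n N : ℕ} {M : Type*} [AddCommMonoid M] {v w : Fin n → ℕ}
    (hv : Monotone v) (hN : ∀ i, v i < N) {ρ₀ : Equiv.Perm (Fin n)} (hρ₀ : ρ₀ ∈ fiberShuffles w)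
    (F : Equiv.Perm (Fin n) → M) :
    ∑ p ∈ (fiberShuffles v ×ˢ fiberShuffles w).filter (fun p => v ∘ p.2 = v ∘ ρ₀), F (p.1 * p.2) =
      ∑ τ ∈ fiberShuffles (pairWord N w (v ∘ ρ₀)), F τ := by
  have hr : ∀ i, (v ∘ ρ₀) i < N := fun i => hN _
  -- The left factor `π` sorts `v ∘ π⁻¹`, which is a function of the product `πρ` once `v ∘ ρ` is
  -- fixed.
  have aux : ∀ π ρ : Equiv.Perm (Fin n), v ∘ ρ = v ∘ ρ₀ → π ∈ fiberShuffles v →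
      π = Tuple.sort ((v ∘ ρ₀) ∘ ⇑(π * ρ)⁻¹) := by
    intro π ρ h hπ
    refine fiberShuffles_eq_sort hv hπ ?_
    rw [← h]
    ext i
    simp
  refine Finset.sum_bij (fun p _ => p.1 * p.2) ?_ ?_ ?_ fun _ _ => rfl
  · rintro ⟨π, ρ⟩ h
    simp only [Finset.mem_filter, Finset.mem_product] at h
    obtain ⟨⟨hπ, hρ⟩, h⟩ := h
    rw [mem_fiberShuffles]
    intro i j hij hg
    rw [pairWord_eq_iff hr, ← h] at hg
    exact mem_fiberShuffles.1 hπ _ _ (mem_fiberShuffles.1 hρ i j hij hg.1) hg.2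
  · rintro ⟨π, ρ⟩ h ⟨π', ρ'⟩ h' e
    simp only [Finset.mem_filter, Finset.mem_product] at h h' e
    have h1 : π = π' := by
      rw [aux π ρ h.2 h.1.1, aux π' ρ' h'.2 h'.1.1, e]
    subst h1
    rw [mul_right_inj] at e
    rw [e]
  · intro τ hτ
    rw [mem_fiberShuffles] at hτ
    -- For surjectivity, `aux` forces `π` to be the stable sort of this word, and then `ρ = π⁻¹τ`.
    set f : Fin n → ℕ := (v ∘ ρ₀) ∘ ⇑τ⁻¹ with hf
    set π := Tuple.sort f with hπdef
    obtain ⟨hm, hs⟩ := Tuple.eq_sort_iff.1 hπdef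
    have hv' : f ∘ ⇑(τ * ρ₀⁻¹) = v := by
      ext i
      simp [hf]
    have hfv : f ∘ π = v := by
      rw [← hv']
      exact Tuple.unique_monotone hm (hv'.symm ▸ hv)
    have hπ : π ∈ fiberShuffles v := by
      rw [mem_fiberShuffles]
      intro i j hij hvij
      refine hs i j hij ?_
      rw [← hfv] at hvij
      exact hvij
    have hvρ : v ∘ ⇑(π⁻¹ * τ) = v ∘ ρ₀ := by
      ext i
      have := congrFun hfv (π⁻¹ (τ i))
      simp only [Function.comp, Equiv.Perm.mul_apply] at this ⊢
      rw [← this]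
      simp [hf]
    refine ⟨(π, π⁻¹ * τ), ?_, by simp⟩
    simp only [Finset.mem_filter, Finset.mem_product]
    refine ⟨⟨hπ, ?_⟩, hvρ⟩
    rw [mem_fiberShuffles]
    intro i j hij hwij
    -- On a block of `w` the word `v ∘ ρ = v ∘ ρ₀` is weakly increasing. Strict increases are
    -- settled by monotonicity of `v`; ties are settled by `τ`, since `π` preserves the order within
    -- a letter of `v`.
    have hle : v ((π⁻¹ * τ) i) ≤ v ((π⁻¹ * τ) j) := by
      have h1 := congrFun hvρ i
      have h2 := congrFun hvρ j
      simp only [Function.comp] at h1 h2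
      rw [h1, h2]
      exact hv (mem_fiberShuffles.1 hρ₀ i j hij hwij).le
    rcases hle.eq_or_lt with h | h
    · by_contra hcon
      have hne : (π⁻¹ * τ) j ≠ (π⁻¹ * τ) i := fun h => hij.ne' ((π⁻¹ * τ).injective h)
      have h3 := mem_fiberShuffles.1 hπ _ _ (lt_of_le_of_ne (not_lt.1 hcon) hne) h.symm
      have h4 := hτ i j hij ((pairWord_eq_iff hr i j).2 ⟨hwij, by rw [← hvρ]; exact h⟩)
      simp only [← Equiv.Perm.mul_apply, mul_inv_cancel_left] at h3
      exact lt_asymm h3 h4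
    · by_contra hcon
      exact absurd (hv (not_lt.1 hcon)) (not_le.2 h)

/-! ### Block permutations and shuffles of concatenated words -/

section PermProd

variable {n m : ℕ}

@[simp]
theorem permProd_castAdd (σ : Equiv.Perm (Fin n)) (σ' : Equiv.Perm (Fin m)) (i : Fin n) :
    permProd σ σ' (Fin.castAdd m i) = Fin.castAdd m (σ i) := by
  simp [permProd, Equiv.permCongr_apply]

@[simp]
theorem permProd_natAdd (σ : Equiv.Perm (Fin n)) (σ' : Equiv.Perm (Fin m)) (i : Fin m) :
    permProd σ σ' (Fin.natAdd n i) = Fin.natAdd n (σ' i) := by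
  simp [permProd, Equiv.permCongr_apply]

theorem permProd_inv (σ : Equiv.Perm (Fin n)) (σ' : Equiv.Perm (Fin m)) :
    (permProd σ σ')⁻¹ = permProd σ⁻¹ σ'⁻¹ := by
  rw [inv_eq_iff_mul_eq_one]
  ext i
  refine Fin.addCases (fun i => ?_) (fun i => ?_) i <;> simp

/-- The word `0 ⋯ 0 1 ⋯ 1`. -/
def blockWord (n m : ℕ) : Fin (n + m) → ℕ := Fin.append (fun _ => 0) (fun _ => 1)

theorem append_monotone {v : Fin n → ℕ} {w : Fin m → ℕ} (hv : Monotone v) (hw : Monotone w)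
    (h : ∀ i j, v i ≤ w j) : Monotone (Fin.append v w) := by
  intro i j
  refine Fin.addCases (fun i => ?_) (fun i => ?_) i <;>
    refine Fin.addCases (fun j => ?_) (fun j => ?_) j
  · intro hij
    simpa using hv ((Fin.strictMono_castAdd m).le_iff_le.1 hij)
  · intro _
    simpa using h i j
  · intro hij
    simp [Fin.le_def] at hij
    omega
  · intro hij
    simpa using hw ((Fin.strictMono_natAdd n).le_iff_le.1 hij)

theorem blockWord_monotone : Monotone (blockWord n m) :=
  append_monotone monotone_const monotone_const (by simp)

theorem fiberShuffles_blockWord : fiberShuffles (blockWord n m) = shuffles n m := by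
  ext π
  simp only [mem_fiberShuffles, shuffles, Finset.mem_filter, Finset.mem_univ, true_and]
  refine ⟨fun h => ⟨fun i j hij => ?_, fun i j hij => ?_⟩, fun h i j => ?_⟩
  · exact h _ _ (Fin.strictMono_castAdd m hij) (by simp [blockWord])
  · exact h _ _ (Fin.strictMono_natAdd n hij) (by simp [blockWord])
  · refine Fin.addCases (fun i => ?_) (fun i => ?_) i <;>
      refine Fin.addCases (fun j => ?_) (fun j => ?_) j <;> intro hij hb
    · exact h.1 ((Fin.strictMono_castAdd m).lt_iff_lt.1 hij)
    · simp [blockWord] at hb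
    · simp [blockWord] at hb
    · exact h.2 ((Fin.strictMono_natAdd n).lt_iff_lt.1 hij)

theorem permProd_injective :
    Function.Injective fun p : Equiv.Perm (Fin n) × Equiv.Perm (Fin m) => permProd p.1 p.2 := by
  rintro ⟨σ, σ'⟩ ⟨τ, τ'⟩ h
  simp only at h
  have h1 : σ = τ := by
    ext i
    have := congrArg (fun f => f (Fin.castAdd m i)) h
    simpa [Fin.ext_iff] using this
  have h2 : σ' = τ' := by
    ext i
    have := congrArg (fun f => f (Fin.natAdd n i)) h
    simpa [Fin.ext_iff] using this
  rw [h1, h2]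

theorem exists_permProd {ρ : Equiv.Perm (Fin (n + m))} (h : blockWord n m ∘ ρ = blockWord n m) :
    ∃ σ σ', ρ = permProd σ σ' := by
  have key : Set.MapsTo (finSumFinEquiv.symm.permCongr ρ)
      (Set.range (Sum.inl : Fin n → Fin n ⊕ Fin m)) (Set.range Sum.inl) := by
    rintro _ ⟨i, rfl⟩
    have h1 := congrFun h (Fin.castAdd m i)
    simp only [Function.comp, Equiv.permCongr_apply, Equiv.symm_symm, finSumFinEquiv_apply_left]
      at h1 ⊢
    generalize ρ (Fin.castAdd m i) = x at h1 ⊢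
    revert h1
    refine Fin.addCases (fun j => ?_) (fun j => ?_) x <;> intro h1
    · exact ⟨j, by simp⟩
    · simp [blockWord] at h1
  obtain ⟨⟨σ, σ'⟩, hσ⟩ := Equiv.Perm.mem_sumCongrHom_range_of_perm_mapsTo_inl key
  refine ⟨σ, σ', ?_⟩
  rw [permProd]
  change Equiv.Perm.sumCongr σ σ' = _ at hσ
  rw [hσ]
  ext i
  simp [Equiv.permCongr_apply]

open Classical in
/-- Shuffles for a concatenation `v w'` of words with disjoint sets of letters, as products of the
shuffles of two blocks with shuffles for `v` and for `w'`. -/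
theorem sum_fiberShuffles_append {M : Type*} [AddCommMonoid M] (v : Fin n → ℕ) (w : Fin m → ℕ)
    (h : ∀ i j, v i < w j) (F : Equiv.Perm (Fin (n + m)) → M) :
    ∑ σ ∈ fiberShuffles v, ∑ σ' ∈ fiberShuffles w, ∑ π ∈ shuffles n m, F (π * permProd σ σ') =
      ∑ τ ∈ fiberShuffles (Fin.append v w), F τ := by
  have hb : ∀ i, blockWord n m i < 2 := fun i => by
    refine Fin.addCases (fun i => ?_) (fun i => ?_) i <;> simp [blockWord]
  -- A letter of the concatenation already tells the block it lies in, so pairing with the block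
  -- word leaves the fibres unchanged. The claim becomes the composition of shuffles with the block
  -- word as outer word and `ρ₀ = 1`.
  have hpair : fiberShuffles (pairWord 2 (Fin.append v w)
      (blockWord n m ∘ (1 : Equiv.Perm (Fin (n + m))))) =
      fiberShuffles (Fin.append v w) := by
    refine fiberShuffles_congr fun i j => ?_
    rw [pairWord_eq_iff (r := blockWord n m ∘ (1 : Equiv.Perm (Fin (n + m)))) fun i => hb i]
    refine and_iff_left_of_imp fun he => ?_
    revert he
    refine Fin.addCases (fun i => ?_) (fun i => ?_) i <;>
      refine Fin.addCases (fun j => ?_) (fun j => ?_) j <;> simp [blockWord] <;> intro he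
    · exact absurd he (h i j).ne
    · exact absurd he (h j i).ne'
  rw [← hpair, ← sum_fiberShuffles_mul blockWord_monotone hb (one_mem_fiberShuffles _) F,
    Finset.sum_filter, Finset.sum_product_right, fiberShuffles_blockWord, ← Finset.sum_product']
  -- Only the `ρ` preserving the two blocks contribute, and these are the products `σ × σ'`.
  rw [← Finset.sum_filter_add_sum_filter_not (fiberShuffles (Fin.append v w))
    (fun ρ => blockWord n m ∘ ρ = blockWord n m), Finset.sum_eq_zero (s := Finset.filter
    (fun ρ : Equiv.Perm (Fin (n + m)) => ¬blockWord n m ∘ ρ = blockWord n m) _), add_zero]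
  · refine Finset.sum_bij (fun p _ => permProd p.1 p.2) ?_ ?_ ?_ ?_
    · rintro ⟨σ, σ'⟩ hσ
      rw [Finset.mem_product, mem_fiberShuffles, mem_fiberShuffles] at hσ
      rw [Finset.mem_filter, mem_fiberShuffles]
      refine ⟨fun i j => ?_, ?_⟩
      · refine Fin.addCases (fun i => ?_) (fun i => ?_) i <;>
          refine Fin.addCases (fun j => ?_) (fun j => ?_) j <;> simp <;> intro hij he
        · exact hσ.1 i j hij he
        · exact absurd he (h i j).ne
        · exact absurd he (h j i).ne'
        · exact hσ.2 i j hij he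
      · ext i
        refine Fin.addCases (fun i => ?_) (fun i => ?_) i <;> simp [blockWord]
    · intro p _ q _ hpq
      exact permProd_injective hpq
    · intro ρ hρ
      rw [Finset.mem_filter, mem_fiberShuffles] at hρ
      obtain ⟨σ, σ', rfl⟩ := exists_permProd hρ.2
      refine ⟨(σ, σ'), ?_, rfl⟩
      rw [Finset.mem_product, mem_fiberShuffles, mem_fiberShuffles]
      refine ⟨fun i j hij he => ?_, fun i j hij he => ?_⟩
      · have := hρ.1 (Fin.castAdd m i) (Fin.castAdd m j) (Fin.strictMono_castAdd m hij)
          (by simpa using he)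
        rw [permProd_castAdd, permProd_castAdd] at this
        exact (Fin.strictMono_castAdd m).lt_iff_lt.1 this
      · have := hρ.1 (Fin.natAdd n i) (Fin.natAdd n j) (Fin.strictMono_natAdd n hij)
          (by simpa using he)
        rw [permProd_natAdd, permProd_natAdd] at this
        exact (Fin.strictMono_natAdd n).lt_iff_lt.1 this
    · rintro ⟨σ, σ'⟩ hσ
      refine Finset.sum_congr rfl fun π _ => ?_
      rw [if_pos]
      ext i
      refine Fin.addCases (fun i => ?_) (fun i => ?_) i <;> simp [blockWord]
  · intro ρ hρ
    rw [Finset.mem_filter] at hρ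
    refine Finset.sum_eq_zero fun π _ => if_neg hρ.2

end PermProd

/-! ### Concatenation of tensors and the splitting condition -/

section TensorMul

variable (K : Type u) [CommRing K] (V : Type v) [AddCommGroup V] [Module K V]

/-- The multiplication `V^{⊗n} × V^{⊗m} → V^{⊗(n+m)}` of the tensor algebra. -/
def tensorMul (n m : ℕ) : ⨂[K]^n V →ₗ[K] ⨂[K]^m V →ₗ[K] ⨂[K]^(n + m) V :=
  (TensorProduct.mk K (⨂[K]^n V) (⨂[K]^m V)).compr₂
    (TensorPower.mulEquiv (R := K) (M := V)).toLinearMap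

variable {K V}

theorem tensorMul_apply {n m : ℕ} (t : ⨂[K]^n V) (s : ⨂[K]^m V) :
    tensorMul K V n m t s = TensorPower.mulEquiv (t ⊗ₜ[K] s) := rfl

theorem tensorMul_tprod {n m : ℕ} (a : Fin n → V) (b : Fin m → V) :
    tensorMul K V n m (PiTensorProduct.tprod K a) (PiTensorProduct.tprod K b) =
      PiTensorProduct.tprod K (Fin.append a b) :=
  TensorPower.tprod_mul_tprod K a b

theorem permLin_apply {n : ℕ} (π : Equiv.Perm (Fin n)) (t : ⨂[K]^n V) :
    permLin K V π t = π • t := rfl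

theorem permProd_smul_tensorMul {n m : ℕ} (σ : Equiv.Perm (Fin n)) (σ' : Equiv.Perm (Fin m))
    (t : ⨂[K]^n V) (s : ⨂[K]^m V) :
    permProd σ σ' • tensorMul K V n m t s = tensorMul K V n m (σ • t) (σ' • s) := by
  suffices h : (tensorMul K V n m).compr₂ (permLin K V (permProd σ σ')) =
      (tensorMul K V n m).compl₁₂ (permLin K V σ) (permLin K V σ') from
    LinearMap.congr_fun₂ h t s
  ext a b
  simp only [LinearMap.compMultilinearMap_apply, LinearMap.compr₂_apply, LinearMap.compl₁₂_apply,
    permLin_apply, perm_smul_tprod, tensorMul_tprod]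
  congr 1
  ext i
  rw [permProd_inv]
  refine Fin.addCases (fun i => ?_) (fun i => ?_) i <;> simp

/-- Condition (A) for compositions with two positive parts. -/
def SplitsTwo (W : (n : ℕ) → Submodule K (⨂[K]^n V)) : Prop :=
  ∀ n m : ℕ, 0 < n → 0 < m → W (n + m) ≤ Submodule.map₂ (tensorMul K V n m) (W n) (W m)

/-- The product of the two homogeneous submodules sits in degree `n + m` of the tensor algebra, into
which `V^{⊗(n+m)}` injects. -/
theorem ConditionA.splitsTwo {W : (n : ℕ) → Submodule K (⨂[K]^n V)} (hW : ConditionA W) :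
    SplitsTwo W := by
  intro n m hn hm t ht
  have h := hW (n + m) (by omega) [n, m] (by simp) (Submodule.mem_map_of_mem ht)
  simp only [List.map_cons, List.map_nil, List.prod_cons, List.prod_nil, mul_one] at h
  have hle : (W n).map (DirectSum.lof K ℕ (fun i : ℕ => ⨂[K]^i V) n) *
      (W m).map (DirectSum.lof K ℕ (fun i : ℕ => ⨂[K]^i V) m) ≤
      (Submodule.map₂ (tensorMul K V n m) (W n) (W m)).map
        (DirectSum.lof K ℕ (fun i : ℕ => ⨂[K]^i V) (n + m)) := by
    rw [Submodule.mul_le]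
    rintro _ ⟨x, hx, rfl⟩ _ ⟨y, hy, rfl⟩
    refine ⟨tensorMul K V n m x y, Submodule.apply_mem_map₂ _ hx hy, ?_⟩
    exact (DirectSum.of_mul_of (A := fun i : ℕ => ⨂[K]^i V) x y).symm
  obtain ⟨s, hs, he⟩ := hle h
  have := DFinsupp.single_injective (β := fun i : ℕ => ⨂[K]^i V) he
  rwa [← this]

end TensorMul

/-! ### Insertion of tensors at prescribed places -/

section Insertion

variable (K : Type u) [CommRing K] {A : Type v} [Ring A] [Algebra K A]

theorem extend_update {m n : ℕ} [DecidableEq (Fin m)] (e : Fin m ↪ Fin n) (a : Fin m → A)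
    (i : Fin m) (x : A) : Function.extend e (Function.update a i x) 1 =
      Function.update (Function.extend e a 1) (e i) x := by
  ext q
  by_cases hq : ∃ p, e p = q
  · obtain ⟨p, rfl⟩ := hq
    rw [e.injective.extend_apply]
    by_cases hp : p = i
    · subst hp; simp
    · rw [Function.update_of_ne hp, Function.update_of_ne (fun h => hp (e.injective h)),
        e.injective.extend_apply]
  · rw [Function.extend_apply' _ _ _ hq, Function.update_of_ne (fun h => hq ⟨i, h.symm⟩),
      Function.extend_apply' _ _ _ hq]

/-- The linear map `A^{⊗m} → A^{⊗n}` that puts the factors in the places given by `e` and fills the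
other places with `1`. -/
def insertion {m n : ℕ} (e : Fin m ↪ Fin n) : ⨂[K]^m A →ₗ[K] ⨂[K]^n A :=
  PiTensorProduct.lift
    { toFun := fun a => PiTensorProduct.tprod K (Function.extend e a 1)
      map_update_add' := fun a i x y => by
        simp only [extend_update, MultilinearMap.map_update_add]
      map_update_smul' := fun a i c x => by
        simp only [extend_update, MultilinearMap.map_update_smul] }

variable {K}

theorem insertion_tprod {m n : ℕ} (e : Fin m ↪ Fin n) (a : Fin m → A) :
    insertion K e (PiTensorProduct.tprod K a) =
      PiTensorProduct.tprod K (Function.extend e a 1) :=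
  PiTensorProduct.lift.tprod _

theorem insertion_mul {m n : ℕ} (e : Fin m ↪ Fin n) (x y : ⨂[K]^m A) :
    insertion K e (x * y) = insertion K e x * insertion K e y := by
  suffices h : (LinearMap.mul K (⨂[K]^m A)).compr₂ (insertion K e) =
      (LinearMap.mul K (⨂[K]^n A)).compl₁₂ (insertion K e) (insertion K e) from
    LinearMap.congr_fun₂ h x y
  ext a b
  simp only [LinearMap.compMultilinearMap_apply, LinearMap.compr₂_apply, LinearMap.compl₁₂_apply,
    LinearMap.mul_apply', PiTensorProduct.tprod_mul_tprod, insertion_tprod]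
  congr 1
  rw [← Function.extend_mul, one_mul]

theorem insertion_one {m n : ℕ} (e : Fin m ↪ Fin n) : insertion K e (1 : ⨂[K]^m A) = 1 := by
  rw [PiTensorProduct.one_def, insertion_tprod]
  congr 1
  ext q
  by_cases hq : ∃ p, e p = q
  · obtain ⟨p, rfl⟩ := hq
    rw [e.injective.extend_apply]; rfl
  · rw [Function.extend_apply' _ _ _ hq]

theorem insertion_commute {m m' n : ℕ} {e : Fin m ↪ Fin n} {e' : Fin m' ↪ Fin n}
    (h : ∀ i j, e i ≠ e' j) (x : ⨂[K]^m A) (y : ⨂[K]^m' A) :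
    Commute (insertion K e x) (insertion K e' y) := by
  suffices h : (LinearMap.mul K (⨂[K]^n A)).compl₁₂ (insertion K e) (insertion K e') =
      ((LinearMap.mul K (⨂[K]^n A)).compl₁₂ (insertion K e') (insertion K e)).flip from
    LinearMap.congr_fun₂ h x y
  ext a b
  simp only [LinearMap.compMultilinearMap_apply, LinearMap.flip_apply, LinearMap.compl₁₂_apply,
    LinearMap.mul_apply', PiTensorProduct.tprod_mul_tprod, insertion_tprod]
  congr 1
  ext q
  by_cases hq : ∃ p, e p = q
  · have hq' : ¬∃ p, e' p = q := by
      rintro ⟨p', hp'⟩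
      obtain ⟨p, hp⟩ := hq
      exact h p p' (hp.trans hp'.symm)
    simp [Function.extend_apply' _ _ _ hq']
  · simp [Function.extend_apply' _ _ _ hq]

theorem extend_comp_equiv {m n : ℕ} (e : Fin m ↪ Fin n) (σ : Equiv.Perm (Fin n)) (a : Fin m → A) :
    (fun i => Function.extend e a 1 (σ⁻¹ i)) = Function.extend (e.trans σ.toEmbedding) a 1 := by
  ext q
  by_cases hq : ∃ p, e p = σ⁻¹ q
  · obtain ⟨p, hp⟩ := hq
    have : q = (e.trans σ.toEmbedding) p := by simp [hp]
    rw [← hp, e.injective.extend_apply, this, (e.trans σ.toEmbedding).injective.extend_apply]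
  · rw [Function.extend_apply' _ _ _ hq, Function.extend_apply']
    · rfl
    · rintro ⟨p, hp⟩
      exact hq ⟨p, by simp [← hp]⟩

theorem smul_insertion {m n : ℕ} (e : Fin m ↪ Fin n) (σ : Equiv.Perm (Fin n)) (x : ⨂[K]^m A) :
    σ • insertion K e x = insertion K (e.trans σ.toEmbedding) x := by
  suffices h : permLin K A σ ∘ₗ insertion K e = insertion K (e.trans σ.toEmbedding) from
    LinearMap.congr_fun h x
  ext a
  simp only [LinearMap.compMultilinearMap_apply, LinearMap.comp_apply, insertion_tprod,
    permLin_apply, perm_smul_tprod, extend_comp_equiv]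

theorem insertion_perm_smul {m n : ℕ} (e : Fin m ↪ Fin n) (σ : Equiv.Perm (Fin m)) (x : ⨂[K]^m A) :
    insertion K e (σ • x) = insertion K (σ.toEmbedding.trans e) x := by
  suffices h : insertion K e ∘ₗ permLin K A σ = insertion K (σ.toEmbedding.trans e) from
    LinearMap.congr_fun h x
  ext a
  simp only [LinearMap.compMultilinearMap_apply, LinearMap.comp_apply, insertion_tprod,
    permLin_apply, perm_smul_tprod]
  congr 1
  ext q
  by_cases hq : ∃ p, e p = q
  · obtain ⟨p, rfl⟩ := hq
    have : e p = (σ.toEmbedding.trans e) (σ⁻¹ p) := by simp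
    rw [e.injective.extend_apply, this, (σ.toEmbedding.trans e).injective.extend_apply]
  · rw [Function.extend_apply' _ _ _ hq, Function.extend_apply']
    rintro ⟨p, hp⟩
    exact hq ⟨σ p, hp⟩

theorem insertion_insertion {k m n : ℕ} (e : Fin k ↪ Fin m) (e' : Fin m ↪ Fin n) (x : ⨂[K]^k A) :
    insertion K e' (insertion K e x) = insertion K (e.trans e') x := by
  suffices h : insertion K e' ∘ₗ insertion K e = insertion K (A := A) (e.trans e') from
    LinearMap.congr_fun h x
  ext a
  simp only [LinearMap.compMultilinearMap_apply, LinearMap.comp_apply, insertion_tprod]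
  congr 1
  ext q
  by_cases hq : ∃ p, e' p = q
  · obtain ⟨p, rfl⟩ := hq
    rw [e'.injective.extend_apply]
    by_cases hp : ∃ r, e r = p
    · obtain ⟨r, rfl⟩ := hp
      have : e' (e r) = (e.trans e') r := rfl
      rw [e.injective.extend_apply, this, (e.trans e').injective.extend_apply]
    · rw [Function.extend_apply' _ _ _ hp, Function.extend_apply']
      · rfl
      · rintro ⟨r, hr⟩
        exact hp ⟨r, e'.injective hr⟩
  · rw [Function.extend_apply' _ _ _ hq, Function.extend_apply']
    rintro ⟨r, hr⟩
    exact hq ⟨e r, hr⟩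

theorem insertion_refl {n : ℕ} (x : ⨂[K]^n A) :
    insertion K (Function.Embedding.refl _) x = x := by
  suffices h : insertion K (A := A) (Function.Embedding.refl (Fin n)) = LinearMap.id from
    LinearMap.congr_fun h x
  ext a
  simp only [LinearMap.compMultilinearMap_apply, insertion_tprod, LinearMap.id_apply]
  congr 1
  ext q
  exact (Function.Embedding.refl (Fin n)).injective.extend_apply a 1 q

/-- Concatenation of two embeddings with disjoint ranges. -/
def appendEmb {m m' n : ℕ} (e : Fin m ↪ Fin n) (e' : Fin m' ↪ Fin n) (h : ∀ i j, e i ≠ e' j) :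
    Fin (m + m') ↪ Fin n :=
  ⟨Fin.append e e', Fin.append_injective_iff.2 ⟨e.injective, e'.injective, h⟩⟩

theorem insertion_appendEmb {m m' n : ℕ} (e : Fin m ↪ Fin n) (e' : Fin m' ↪ Fin n)
    (h : ∀ i j, e i ≠ e' j) (x : ⨂[K]^m A) (y : ⨂[K]^m' A) :
    insertion K (appendEmb e e' h) (tensorMul K A m m' x y) =
      insertion K e x * insertion K e' y := by
  suffices h : (tensorMul K A m m').compr₂ (insertion K (appendEmb e e' h)) =
      (LinearMap.mul K (⨂[K]^n A)).compl₁₂ (insertion K e) (insertion K e') from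
    LinearMap.congr_fun₂ h x y
  ext a b
  simp only [LinearMap.compMultilinearMap_apply, LinearMap.compr₂_apply, LinearMap.compl₁₂_apply,
    LinearMap.mul_apply', PiTensorProduct.tprod_mul_tprod, insertion_tprod, tensorMul_tprod]
  congr 1
  ext q
  by_cases hq : ∃ p, e p = q
  · have hq' : ¬∃ p, e' p = q := by
      rintro ⟨p', hp'⟩
      obtain ⟨p, hp⟩ := hq
      exact h p p' (hp.trans hp'.symm)
    obtain ⟨p, rfl⟩ := hq
    have : e p = appendEmb e e' h (Fin.castAdd m' p) := by simp [appendEmb]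
    rw [Pi.mul_apply, Function.extend_apply' _ _ _ hq', e.injective.extend_apply, this,
      (appendEmb e e' h).injective.extend_apply]
    simp
  · by_cases hq' : ∃ p, e' p = q
    · obtain ⟨p, rfl⟩ := hq'
      have : e' p = appendEmb e e' h (Fin.natAdd m p) := by simp [appendEmb]
      rw [Pi.mul_apply, Function.extend_apply' _ _ _ hq, e'.injective.extend_apply, this,
        (appendEmb e e' h).injective.extend_apply]
      simp
    · rw [Pi.mul_apply, Function.extend_apply' _ _ _ hq, Function.extend_apply' _ _ _ hq',
        Function.extend_apply']
      · simp
      · rintro ⟨p, hp⟩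
        revert hp
        refine Fin.addCases (fun p => ?_) (fun p => ?_) p <;> intro hp
        · exact hq ⟨p, by simpa [appendEmb] using hp⟩
        · exact hq' ⟨p, by simpa [appendEmb] using hp⟩

theorem castAdd_ne_natAdd {n m : ℕ} (i : Fin n) (j : Fin m) :
    Fin.castAddEmb m i ≠ Fin.natAddEmb n j := by
  simp [Fin.ext_iff]
  omega

/-- Turns concatenation into multiplication inside the fixed algebra `A^{⊗(n+m)}`. -/
theorem tensorMul_eq_insertion_mul {n m : ℕ} (x : ⨂[K]^n A) (y : ⨂[K]^m A) :
    tensorMul K A n m x y =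
      insertion K (Fin.castAddEmb m) x * insertion K (Fin.natAddEmb n) y := by
  rw [← insertion_appendEmb _ _ castAdd_ne_natAdd]
  have : appendEmb (Fin.castAddEmb m) (Fin.natAddEmb n) castAdd_ne_natAdd =
      Function.Embedding.refl (Fin (n + m)) := by
    ext i
    refine Fin.addCases (fun i => ?_) (fun i => ?_) i <;> simp [appendEmb]
  rw [this, insertion_refl]

/-- Two embeddings with the same range differ by a permutation of the source, which a symmetric
tensor absorbs. -/
theorem insertion_eq_of_range_eq {m n : ℕ} {e e' : Fin m ↪ Fin n}
    (h : Set.range e = Set.range e') {x : ⨂[K]^m A} (hx : x ∈ symTensors K A m) :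
    insertion K e x = insertion K e' x := by
  let σ : Equiv.Perm (Fin m) := (Equiv.ofInjective e e.injective).trans
    ((Equiv.setCongr h).trans (Equiv.ofInjective e' e'.injective).symm)
  have hσ : σ.toEmbedding.trans e' = e := by
    ext i
    have := Equiv.apply_ofInjective_symm e'.injective
      (Equiv.setCongr h (Equiv.ofInjective e e.injective i))
    simp only [Function.Embedding.trans_apply, Equiv.coe_toEmbedding]
    exact congrArg Fin.val this
  conv_rhs => rw [← mem_symTensors.1 hx σ, insertion_perm_smul, hσ]

end Insertion

/-! ### Tensors with factors distributed along a word -/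

section Words

variable {K : Type u} [CommRing K] {A : Type v} [Ring A] [Algebra K A]

/-- The elements of `B_{|S|}`, put in the places in `S`. -/
def placed (B : (n : ℕ) → Submodule K (⨂[K]^n A)) {n : ℕ} (S : Finset (Fin n)) :
    Submodule K (⨂[K]^n A) :=
  (B S.card).map (insertion K (S.orderEmbOfFin rfl).toEmbedding)

/-- The positions of the letter `l` in the word `w`. -/
def positions {n : ℕ} {L : Type*} [DecidableEq L] (w : Fin n → L) (l : L) : Finset (Fin n) :=
  Finset.univ.filter fun i => w i = l

theorem mem_positions {n : ℕ} {L : Type*} [DecidableEq L] {w : Fin n → L} {l : L} {i : Fin n} :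
    i ∈ positions w l ↔ w i = l := by
  simp [positions]

/-- The product of the modules `placed B (positions w l)`, where `l` runs over the list `I`. -/
def wordTensors (B : (n : ℕ) → Submodule K (⨂[K]^n A)) {n : ℕ} (I : List ℕ) (w : Fin n → ℕ) :
    Submodule K (⨂[K]^n A) :=
  (I.map fun l => placed B (positions w l)).prod

variable {B : (n : ℕ) → Submodule K (⨂[K]^n A)}

section Placed

theorem range_orderEmbOfFin_trans {m n : ℕ} (S : Finset (Fin m)) (e : Fin m ↪ Fin n) :
    Set.range ((S.orderEmbOfFin rfl).toEmbedding.trans e) = (S.map e : Finset (Fin n)) := by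
  have h : ⇑((S.orderEmbOfFin rfl).toEmbedding.trans e) = e ∘ S.orderEmbOfFin rfl := rfl
  rw [h, Set.range_comp, Finset.range_orderEmbOfFin, Finset.coe_map]

theorem insertion_mem_placed (hC : ConditionC B) {m n : ℕ} (e : Fin m ↪ Fin n)
    {S : Finset (Fin n)} (hS : Set.range e = S) {x : ⨂[K]^m A} (hx : x ∈ B m) :
    insertion K e x ∈ placed B S := by
  have hm : m = S.card := by
    have : S = Finset.univ.map e := by
      rw [← Finset.coe_inj, ← hS]
      simp
    rw [this]; simp
  subst hm
  refine ⟨x, hx, insertion_eq_of_range_eq ?_ (hC _ hx)⟩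
  rw [hS]
  exact S.range_orderEmbOfFin rfl

theorem exists_of_mem_placed (hC : ConditionC B) {m n : ℕ} (e : Fin m ↪ Fin n)
    {S : Finset (Fin n)} (hS : Set.range e = S) {y : ⨂[K]^n A} (hy : y ∈ placed B S) :
    ∃ x ∈ B m, insertion K e x = y := by
  have hm : m = S.card := by
    have : S = Finset.univ.map e := by
      rw [← Finset.coe_inj, ← hS]
      simp
    rw [this]; simp
  subst hm
  obtain ⟨x, hx, rfl⟩ := hy
  refine ⟨x, hx, insertion_eq_of_range_eq ?_ (hC _ hx)⟩
  rw [hS]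
  exact (S.range_orderEmbOfFin rfl).symm

theorem placed_eq_map (hC : ConditionC B) {m n : ℕ} (e : Fin m ↪ Fin n)
    {S : Finset (Fin n)} (hS : Set.range e = S) : placed B S = (B m).map (insertion K e) := by
  ext y
  refine ⟨fun hy => exists_of_mem_placed hC e hS hy, ?_⟩
  rintro ⟨x, hx, rfl⟩
  exact insertion_mem_placed hC e hS hx

theorem placed_map (hC : ConditionC B) {m n : ℕ} (e : Fin m ↪ Fin n) (S : Finset (Fin m)) :
    placed B (S.map e) = (placed B S).map (insertion K e) := by
  rw [placed_eq_map hC ((S.orderEmbOfFin rfl).toEmbedding.trans e), placed, ← Submodule.map_comp]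
  · congr 1
    ext x
    simp [insertion_insertion]
  · exact range_orderEmbOfFin_trans S e

/-- Since `A^{⊗0}` is `K`, the insertion has image the scalars. Letters that do not occur in a word
therefore contribute a trivial factor. -/
theorem placed_empty (hC : ConditionC B) (h0 : B 0 = ⊤) {n : ℕ} :
    placed B (∅ : Finset (Fin n)) = 1 := by
  rw [placed_eq_map hC (⟨Fin.elim0, fun i => i.elim0⟩ : Fin 0 ↪ Fin n)
    (by simp [Set.range_eq_empty]), h0, Submodule.map_top]
  ext y
  rw [Submodule.mem_one]
  constructor
  · rintro ⟨x, rfl⟩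
    obtain ⟨r, rfl⟩ := (TensorPower.algebraMap₀ (R := K) (M := A)).surjective x
    refine ⟨r, ?_⟩
    have : (TensorPower.algebraMap₀ r : ⨂[K]^0 A) = r • 1 := by
      rw [TensorPower.algebraMap₀_eq_smul_one, TensorPower.gOne_def, PiTensorProduct.one_def]
      exact congrArg (fun a => r • PiTensorProduct.tprod K a) (Subsingleton.elim _ _)
    rw [this, map_smul, insertion_one, Algebra.algebraMap_eq_smul_one]
  · rintro ⟨r, rfl⟩
    exact ⟨r • 1, by rw [map_smul, insertion_one, Algebra.algebraMap_eq_smul_one]⟩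

/-- At every place one of the two factors is `1`. -/
theorem placed_commute {n : ℕ} {S T : Finset (Fin n)} (h : Disjoint S T) :
    Commute (placed B S) (placed B T) := by
  refine Submodule.mul_comm_of_commute ?_
  rintro _ ⟨x, -, rfl⟩ _ ⟨y, -, rfl⟩
  refine insertion_commute (fun i j hij => ?_) x y
  have h1 := S.orderEmbOfFin_mem rfl i
  have h2 := T.orderEmbOfFin_mem rfl j
  exact Finset.disjoint_left.1 h h1 (by
    change S.orderEmbOfFin rfl i = T.orderEmbOfFin rfl j at hij
    rwa [hij])

theorem placed_mul_self (hB : ConditionB B) {n : ℕ} (S : Finset (Fin n)) :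
    placed B S * placed B S ≤ placed B S := by
  rw [Submodule.mul_le]
  rintro _ ⟨x, hx, rfl⟩ _ ⟨y, hy, rfl⟩
  exact ⟨x * y, hB _ x hx y hy, insertion_mul _ _ _⟩

/-- This is the splitting condition, transported along the concatenation of the two order
embeddings. That concatenation need not be increasing, which is harmless by symmetry; an empty set
is treated apart because splitting concerns positive parts. -/
theorem placed_union (hA : SplitsTwo B) (hC : ConditionC B) (h0 : B 0 = ⊤) {n : ℕ}
    {S T : Finset (Fin n)} (h : Disjoint S T) :
    placed B (S ∪ T) ≤ placed B S * placed B T := by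
  rcases S.eq_empty_or_nonempty with rfl | hS
  · rw [placed_empty hC h0, one_mul, Finset.empty_union]
  rcases T.eq_empty_or_nonempty with rfl | hT
  · rw [placed_empty hC h0, mul_one, Finset.union_empty]
  have hd : ∀ i j, (S.orderEmbOfFin rfl).toEmbedding i ≠ (T.orderEmbOfFin rfl).toEmbedding j := by
    intro i j hij
    have h1 := S.orderEmbOfFin_mem rfl i
    have h2 := T.orderEmbOfFin_mem rfl j
    exact Finset.disjoint_left.1 h h1 (by
      change S.orderEmbOfFin rfl i = T.orderEmbOfFin rfl j at hij
      rwa [hij])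
  intro y hy
  obtain ⟨x, hx, rfl⟩ := exists_of_mem_placed hC (appendEmb _ _ hd) (by
    change Set.range (Fin.append _ _) = _
    have h1 : Set.range ⇑(S.orderEmbOfFin rfl).toEmbedding = S := S.range_orderEmbOfFin rfl
    have h2 : Set.range ⇑(T.orderEmbOfFin rfl).toEmbedding = T := T.range_orderEmbOfFin rfl
    rw [Finset.coe_union, ← h1, ← h2]
    ext q
    simp only [Set.mem_range, Set.mem_union]
    constructor
    · rintro ⟨i, rfl⟩
      refine Fin.addCases (fun i => ?_) (fun i => ?_) i
      · exact Or.inl ⟨i, by rw [Fin.append_left]⟩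
      · exact Or.inr ⟨i, by rw [Fin.append_right]⟩
    · rintro (⟨i, rfl⟩ | ⟨i, rfl⟩)
      · exact ⟨Fin.castAdd _ i, Fin.append_left _ _ _⟩
      · exact ⟨Fin.natAdd _ i, Fin.append_right _ _ _⟩) hy
  have hx' := hA _ _ hS.card_pos hT.card_pos hx
  have hle : (Submodule.map₂ (tensorMul K A _ _) (B S.card) (B T.card)) ≤
      (placed B S * placed B T).comap (insertion K (appendEmb _ _ hd)) := by
    rw [Submodule.map₂_le]
    intro a ha b hb
    rw [Submodule.mem_comap, insertion_appendEmb]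
    exact Submodule.mul_mem_mul ⟨a, ha, rfl⟩ ⟨b, hb, rfl⟩
  exact hle hx'

theorem placed_le_list_prod (hA : SplitsTwo B) (hC : ConditionC B) (h0 : B 0 = ⊤) {n : ℕ}
    (w : Fin n → ℕ) (J : List ℕ) (hJ : J.Nodup) :
    placed B (Finset.univ.filter fun i => w i ∈ J) ≤ wordTensors B J w := by
  induction J with
  | nil => simp [wordTensors, placed_empty hC h0]
  | cons j J ih =>
    rw [List.nodup_cons] at hJ
    have hu : (Finset.univ.filter fun i => w i ∈ j :: J) =
        positions w j ∪ Finset.univ.filter fun i => w i ∈ J := by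
      ext i
      simp [mem_positions]
    rw [hu, wordTensors, List.map_cons, List.prod_cons]
    refine (placed_union hA hC h0 ?_).trans (mul_le_mul_right (ih hJ.2) _)
    rw [Finset.disjoint_left]
    intro i hi hi'
    rw [mem_positions] at hi
    simp only [Finset.mem_filter, Finset.mem_univ, true_and, hi] at hi'
    exact hJ.1 hi'

end Placed

theorem positions_disjoint {n : ℕ} (w : Fin n → ℕ) {i j : ℕ} (h : i ≠ j) :
    Disjoint (positions w i) (positions w j) := by
  rw [Finset.disjoint_left]
  intro p hp hp'
  rw [mem_positions] at hp hp'
  exact h (hp.symm.trans hp')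

theorem pairwise_commute_placed {n : ℕ} (w : Fin n → ℕ) {I : List ℕ} (hI : I.Nodup) :
    (I.map fun l => placed B (positions w l)).Pairwise Commute :=
  List.pairwise_map.2 (hI.imp fun h => placed_commute (positions_disjoint w h))

theorem wordTensors_perm {n : ℕ} (w : Fin n → ℕ) {I J : List ℕ} (hI : I.Nodup) (h : I.Perm J) :
    wordTensors B I w = wordTensors B J w :=
  (h.map _).prod_eq' (pairwise_commute_placed w hI)

/-- Factors at different letters commute, so the product can be regrouped letter by letter, where
(B) applies. -/
theorem wordTensors_mul_self (hB : ConditionB B) {n : ℕ} (w : Fin n → ℕ) {I : List ℕ}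
    (hI : I.Nodup) : wordTensors B I w * wordTensors B I w ≤ wordTensors B I w := by
  induction I with
  | nil => simp [wordTensors]
  | cons i I ih =>
    rw [List.nodup_cons] at hI
    have hc : Commute (wordTensors B I w) (placed B (positions w i)) := by
      refine (Commute.list_prod_right _ _ fun x hx => ?_).symm
      obtain ⟨j, hj, rfl⟩ := List.mem_map.1 hx
      exact placed_commute (positions_disjoint w fun h => hI.1 (h ▸ hj))
    change placed B (positions w i) * wordTensors B I w *
      (placed B (positions w i) * wordTensors B I w) ≤
      placed B (positions w i) * wordTensors B I w
    rw [hc.mul_mul_mul_comm]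
    exact mul_le_mul' (placed_mul_self hB _) (ih hI.2)

theorem wordTensors_flatMap {n : ℕ} (w : Fin n → ℕ) (I : List ℕ) (f : ℕ → List ℕ) :
    wordTensors B (I.flatMap f) w = (I.map fun i => wordTensors B (f i) w).prod := by
  induction I with
  | nil => simp [wordTensors]
  | cons i I ih => simp [wordTensors, List.flatMap_cons] at ih ⊢; rw [ih]

/-- Refinement of words. -/
theorem wordTensors_le (hA : SplitsTwo B) (hC : ConditionC B) (h0 : B 0 = ⊤) {n : ℕ}
    {v w : Fin n → ℕ} {I J : List ℕ} (hI : I.Nodup) (hJ : J.Nodup) (φ : ℕ → ℕ)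
    (hφ : ∀ p, φ (w p) = v p) (hIJ : ∀ j ∈ J, φ j ∈ I) (hw : ∀ p, w p ∈ J) :
    wordTensors B I v ≤ wordTensors B J w := by
  -- Regroup the letters of the finer word by their image under `φ`; each letter of `v` is then
  -- split separately.
  have hp : (I.flatMap fun i => J.filter fun j => φ j = i).Perm J := by
    refine (List.perm_ext_iff_of_nodup ?_ hJ).2 fun j => ?_
    · rw [List.nodup_flatMap]
      refine ⟨fun i _ => hJ.filter _, hI.imp fun {a b} hab => ?_⟩
      intro j h1 h2
      simp only [List.mem_filter, decide_eq_true_eq] at h1 h2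
      exact hab (h1.2.symm.trans h2.2)
    · simp only [List.mem_flatMap, List.mem_filter, decide_eq_true_eq]
      exact ⟨fun ⟨_, _, h, _⟩ => h, fun h => ⟨_, hIJ j h, h, rfl⟩⟩
  rw [wordTensors_perm w hJ hp.symm, wordTensors_flatMap]
  refine List.prod_le_prod' fun i _ => ?_
  refine le_trans (le_of_eq ?_) (placed_le_list_prod hA hC h0 w _ (hJ.filter _))
  congr 1
  ext p
  simp [mem_positions, hw, hφ]

theorem positions_comp_perm {n : ℕ} (w : Fin n → ℕ) (σ : Equiv.Perm (Fin n)) (l : ℕ) :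
    positions (w ∘ σ) l = (positions w l).map (σ⁻¹ : Equiv.Perm (Fin n)).toEmbedding := by
  ext i
  simp only [mem_positions, Function.comp, Finset.mem_map, Equiv.coe_toEmbedding]
  exact ⟨fun h => ⟨σ i, h, by simp⟩, by rintro ⟨j, hj, rfl⟩; simpa using hj⟩

theorem list_prod_le_comap {R : Type*} [Ring R] [Algebra K R] {ι : Type*} (I : List ι)
    (M N : ι → Submodule K R) (f : R →ₐ[K] R) (h : ∀ i ∈ I, M i ≤ (N i).comap f.toLinearMap) :
    (I.map M).prod ≤ ((I.map N).prod).comap f.toLinearMap := by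
  induction I with
  | nil =>
    simp only [List.map_nil, List.prod_nil]
    rw [Submodule.one_le]
    simp [Submodule.one_le.1 le_rfl]
  | cons i I ih =>
    simp only [List.map_cons, List.prod_cons]
    rw [Submodule.mul_le]
    intro x hx y hy
    rw [Submodule.mem_comap, AlgHom.toLinearMap_apply, map_mul]
    exact Submodule.mul_mem_mul (h i (by simp) hx)
      (ih (fun j hj => h j (List.mem_cons_of_mem _ hj)) hy)

/-- The action of a permutation as a homomorphism of algebras. -/
def permAlgHom {n : ℕ} (σ : Equiv.Perm (Fin n)) : ⨂[K]^n A →ₐ[K] ⨂[K]^n A :=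
  AlgHom.ofLinearMap (permLin K A σ) (smul_one σ) (smul_mul' σ)

theorem permAlgHom_apply {n : ℕ} (σ : Equiv.Perm (Fin n)) (x : ⨂[K]^n A) :
    permAlgHom σ x = σ • x := rfl

/-- Insertion as a homomorphism of algebras. -/
def insertionAlgHom {m n : ℕ} (e : Fin m ↪ Fin n) : ⨂[K]^m A →ₐ[K] ⨂[K]^n A :=
  AlgHom.ofLinearMap (insertion K e) (insertion_one e) (insertion_mul e)

/-- Permuting the places moves the block of each letter, and by symmetry the order inside the moved
block is irrelevant. -/
theorem smul_mem_wordTensors (hC : ConditionC B) {n : ℕ} {I : List ℕ} {w : Fin n → ℕ}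
    (σ : Equiv.Perm (Fin n)) {x : ⨂[K]^n A} (hx : x ∈ wordTensors B I w) :
    σ⁻¹ • x ∈ wordTensors B I (w ∘ σ) := by
  refine list_prod_le_comap I _ _ (permAlgHom σ⁻¹) (fun l _ => ?_) hx
  rintro _ ⟨y, hy, rfl⟩
  rw [Submodule.mem_comap, AlgHom.toLinearMap_apply, permAlgHom_apply, smul_insertion]
  refine insertion_mem_placed hC _ ?_ hy
  rw [positions_comp_perm]
  exact range_orderEmbOfFin_trans _ _

/-- A permutation in the Young subgroup of `w` maps each block to itself and so fixes each symmetric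
factor. -/
theorem smul_eq_of_mem_wordTensors (hC : ConditionC B) {n : ℕ} {I : List ℕ} {w : Fin n → ℕ}
    {σ : Equiv.Perm (Fin n)} (hσ : w ∘ σ = w) {x : ⨂[K]^n A} (hx : x ∈ wordTensors B I w) :
    σ • x = x := by
  have key : ∀ I : List ℕ, wordTensors B I w ≤
      LinearMap.eqLocus (permAlgHom σ).toLinearMap (LinearMap.id : ⨂[K]^n A →ₗ[K] _) := by
    intro I
    induction I with
    | nil =>
      rw [wordTensors, List.map_nil, List.prod_nil, Submodule.one_le]
      simp
    | cons i I ih =>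
      rw [wordTensors, List.map_cons, List.prod_cons, Submodule.mul_le]
      rintro _ ⟨y, hy, rfl⟩ z hz
      have hz' := ih hz
      simp only [LinearMap.mem_eqLocus, AlgHom.toLinearMap_apply, LinearMap.id_apply,
        map_mul] at hz' ⊢
      rw [hz', permAlgHom_apply, smul_insertion]
      congr 1
      refine insertion_eq_of_range_eq ?_ (hC _ hy)
      have h2 : (positions w i).map σ.toEmbedding = positions w i := by
        ext p
        simp only [Finset.mem_map, Equiv.coe_toEmbedding, mem_positions]
        constructor
        · rintro ⟨q, hq, rfl⟩
          rw [← hq]; exact congrFun hσ q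
        · intro hp
          refine ⟨σ⁻¹ p, ?_, by simp⟩
          rw [← hp, ← congrFun hσ]
          simp
      have h3 : Set.range ((positions w i).orderEmbOfFin rfl) = positions w i :=
        Finset.range_orderEmbOfFin _ rfl
      conv_rhs => rw [RelEmbedding.coe_toEmbedding, h3, ← h2]
      exact range_orderEmbOfFin_trans _ _
  exact key I hx

section Append

variable {n m : ℕ}

theorem positions_append_left {v : Fin n → ℕ} {w : Fin m → ℕ} {l : ℕ} (h : ∀ j, w j ≠ l) :
    positions (Fin.append v w) l = (positions v l).map (Fin.castAddEmb m) := by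
  ext i
  refine Fin.addCases (fun i => ?_) (fun i => ?_) i
  · simp [mem_positions]
  · simp [mem_positions, h, Fin.ext_iff]
    intro x _
    omega

theorem positions_append_right {v : Fin n → ℕ} {w : Fin m → ℕ} {l : ℕ} (h : ∀ j, v j ≠ l) :
    positions (Fin.append v w) l = (positions w l).map (Fin.natAddEmb n) := by
  ext i
  refine Fin.addCases (fun i => ?_) (fun i => ?_) i
  · simp [mem_positions, h, Fin.ext_iff]
    intro x _
    omega
  · simp [mem_positions]

theorem wordTensors_append (hC : ConditionC B) {I J : List ℕ} {v : Fin n → ℕ} {w : Fin m → ℕ}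
    (hI : ∀ j, w j ∉ I) (hJ : ∀ i, v i ∉ J) :
    wordTensors B (I ++ J) (Fin.append v w) =
      Submodule.map₂ (tensorMul K A n m) (wordTensors B I v) (wordTensors B J w) := by
  have h1 : (I.map fun l => placed B (positions (Fin.append v w) l)).prod =
      (wordTensors B I v).map (insertionAlgHom (Fin.castAddEmb m)).toLinearMap := by
    rw [wordTensors, ← Submodule.mapHom_apply, map_list_prod, List.map_map]
    congr 1
    refine List.map_congr_left fun l hl => ?_
    rw [positions_append_left fun j h => hI j (by rwa [h]), placed_map hC]
    rfl
  have h2 : (J.map fun l => placed B (positions (Fin.append v w) l)).prod =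
      (wordTensors B J w).map (insertionAlgHom (Fin.natAddEmb n)).toLinearMap := by
    rw [wordTensors, ← Submodule.mapHom_apply, map_list_prod, List.map_map]
    congr 1
    refine List.map_congr_left fun l hl => ?_
    rw [positions_append_right fun j h => hJ j (by rwa [h]), placed_map hC]
    rfl
  rw [wordTensors, List.map_append, List.prod_append, h1, h2]
  refine le_antisymm ?_ ?_
  · rw [Submodule.mul_le]
    rintro _ ⟨x, hx, rfl⟩ _ ⟨y, hy, rfl⟩
    have := Submodule.apply_mem_map₂ (tensorMul K A n m) hx hy
    rwa [tensorMul_eq_insertion_mul] at this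
  · rw [Submodule.map₂_le]
    intro x hx y hy
    rw [tensorMul_eq_insertion_mul]
    exact Submodule.mul_mem_mul ⟨x, hx, rfl⟩ ⟨y, hy, rfl⟩

theorem wordTensors_const (hC : ConditionC B) (c : ℕ) :
    wordTensors B [c] (fun _ : Fin n => c) = B n := by
  have h : positions (fun _ : Fin n => c) c = Finset.univ := by ext; simp [mem_positions]
  rw [wordTensors, List.map_singleton, List.prod_singleton, h,
    placed_eq_map hC (Function.Embedding.refl _)
      (by rw [Finset.coe_univ]; exact Set.range_id)]
  ext x
  simp [insertion_refl]

/-- Renaming the letters. -/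
theorem wordTensors_map_comp (I : List ℕ) (w : Fin n → ℕ) {φ : ℕ → ℕ} (hφ : φ.Injective) :
    wordTensors B (I.map φ) (φ ∘ w) = wordTensors B I w := by
  rw [wordTensors, wordTensors, List.map_map]
  congr 1
  refine List.map_congr_left fun l _ => ?_
  simp only [Function.comp]
  congr 1
  ext i
  simp [mem_positions, hφ.eq_iff]

end Append

end Words

/-! ### Descent algebras and sums over shuffles -/

section Descent

variable {K : Type u} [CommRing K] {V : Type v} [AddCommGroup V] [Module K V]

section Closure

variable (W : (n : ℕ) → Submodule K (⨂[K]^n V))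

theorem extOne_mem_descentAlgebra : extOne K V ∈ descentAlgebra W := by
  rw [descentAlgebra, Submodule.mem_sInf]
  exact fun S hS => hS.1

theorem extMul_mem_descentAlgebra {x y : F K V} (hx : x ∈ descentAlgebra W)
    (hy : y ∈ descentAlgebra W) : extMul K V x y ∈ descentAlgebra W := by
  rw [descentAlgebra, Submodule.mem_sInf] at *
  exact fun S hS => hS.2.1 x (hx S hS) y (hy S hS)

variable {W} in
theorem single_one_mem_descentAlgebra {n : ℕ} {t : ⨂[K]^n V} (ht : t ∈ W n) :
    SkewMonoidAlgebra.single 1 t ∈ component (descentAlgebra W) n := by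
  rw [component, Submodule.mem_comap, descentAlgebra, Submodule.mem_sInf]
  exact fun S hS => hS.2.2 n t ht

theorem extMulComp_mem_component {n m : ℕ} {x : FComp K V n} {y : FComp K V m}
    (hx : x ∈ component (descentAlgebra W) n) (hy : y ∈ component (descentAlgebra W) m) :
    extMulComp K V n m x y ∈ component (descentAlgebra W) (n + m) := by
  rw [component, Submodule.mem_comap] at *
  rw [← extMul_lof_lof]
  exact extMul_mem_descentAlgebra W hx hy

/-- `𝓕₀(V)` consists of the multiples of the external unit. -/
theorem single_zero_mem_component (π : Equiv.Perm (Fin 0)) (t : ⨂[K]^0 V) :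
    SkewMonoidAlgebra.single π t ∈ component (descentAlgebra W) 0 := by
  obtain ⟨r, rfl⟩ := (TensorPower.algebraMap₀ (R := K) (M := V)).surjective t
  rw [Subsingleton.elim π 1, TensorPower.algebraMap₀_eq_smul_one, TensorPower.gOne_def,
    ← sharp_apply, map_smul, sharp_apply]
  exact Submodule.smul_mem _ r (extOne_mem_descentAlgebra W)

/-- Generators of degree zero are multiples of the unit, so the component `W 0` can be replaced
freely. -/
theorem descentAlgebra_congr {W W' : (n : ℕ) → Submodule K (⨂[K]^n V)}
    (h : ∀ n, 0 < n → W n = W' n) : descentAlgebra W = descentAlgebra W' := by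
  have key : ∀ W W' : (n : ℕ) → Submodule K (⨂[K]^n V), (∀ n, 0 < n → W n = W' n) →
      descentAlgebra W ≤ descentAlgebra W' := by
    intro W W' h
    refine sInf_le ⟨extOne_mem_descentAlgebra W', fun x hx y hy =>
      extMul_mem_descentAlgebra W' hx hy, fun n t ht => ?_⟩
    rcases n.eq_zero_or_pos with rfl | hn
    · exact single_zero_mem_component W' 1 t
    · rw [h n hn] at ht
      exact single_one_mem_descentAlgebra ht
  exact le_antisymm (key _ _ h) (key _ _ fun n hn => (h n hn).symm)

end Closure

/-- The sum of the `π · (u # e)`, where `π` runs over the shuffles for `w`. -/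
def wordSum {n : ℕ} (w : Fin n → ℕ) (u : ⨂[K]^n V) : FComp K V n :=
  ∑ π ∈ fiberShuffles w, SkewMonoidAlgebra.single π (π • u)

theorem wordSum_const {n : ℕ} (c : ℕ) (u : ⨂[K]^n V) :
    wordSum (fun _ => c) u = SkewMonoidAlgebra.single 1 u := by
  rw [wordSum, fiberShuffles_const, Finset.sum_singleton, one_smul]

theorem extMulComp_wordSum {n m : ℕ} {v : Fin n → ℕ} {w : Fin m → ℕ} (h : ∀ i j, v i < w j)
    (t : ⨂[K]^n V) (s : ⨂[K]^m V) :
    extMulComp K V n m (wordSum v t) (wordSum w s) =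
      wordSum (Fin.append v w) (tensorMul K V n m t s) := by
  classical
  rw [wordSum, wordSum, wordSum, ← sum_fiberShuffles_append v w h]
  rw [map_sum (extMulComp K V n m), LinearMap.sum_apply]
  refine Finset.sum_congr rfl fun σ _ => ?_
  rw [map_sum]
  refine Finset.sum_congr rfl fun σ' _ => ?_
  rw [extMulComp_single_single]
  refine Finset.sum_congr rfl fun π _ => ?_
  rw [← tensorMul_apply, ← permProd_smul_tensorMul, mul_smul]

end Descent

/-! ### Components of the descent algebra and the internal product -/

section Algebra

variable {K : Type u} [CommRing K] {A : Type v} [Ring A] [Algebra K A]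

/-- The span of the sums `wordSum w u`, where `w` is a monotone word and `u` has its factors in
`B`. -/
def wordSpan (B : (n : ℕ) → Submodule K (⨂[K]^n A)) (n : ℕ) : Submodule K (FComp K A n) :=
  Submodule.span K {x | ∃ (N : ℕ) (w : Fin n → ℕ), Monotone w ∧ (∀ i, w i < N) ∧
    ∃ u ∈ wordTensors B (List.range N) w, x = wordSum w u}

variable {B : (n : ℕ) → Submodule K (⨂[K]^n A)}

theorem wordSum_mem_wordSpan {n N : ℕ} {w : Fin n → ℕ} (hw : Monotone w) (hN : ∀ i, w i < N)
    {u : ⨂[K]^n A} (hu : u ∈ wordTensors B (List.range N) w) : wordSum w u ∈ wordSpan B n :=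
  Submodule.subset_span ⟨N, w, hw, hN, u, hu, rfl⟩

theorem extMulComp_mem_wordSpan (hC : ConditionC B) {n m : ℕ} {x : FComp K A n} {y : FComp K A m}
    (hx : x ∈ wordSpan B n) (hy : y ∈ wordSpan B m) :
    extMulComp K A n m x y ∈ wordSpan B (n + m) := by
  suffices h : Submodule.map₂ (extMulComp K A n m) (wordSpan B n) (wordSpan B m) ≤
      wordSpan B (n + m) from h (Submodule.apply_mem_map₂ _ hx hy)
  rw [wordSpan, wordSpan, Submodule.map₂_span_span, Submodule.span_le]
  rintro _ ⟨_, ⟨N, v, hv, hvN, t, ht, rfl⟩, _, ⟨M, w, hw, hwM, s, hs, rfl⟩, rfl⟩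
  -- Shifting the letters of `w` by `N` places them above those of `v`, so that the concatenation is
  -- monotone.
  have hinj : Function.Injective fun l : ℕ => N + l := add_right_injective N
  have hsum : wordSum w s = wordSum ((fun l => N + l) ∘ w) s := by
    rw [wordSum, wordSum, fiberShuffles_congr (w' := (fun l => N + l) ∘ w)]
    intro i j
    simp
  simp only [SetLike.mem_coe]
  rw [hsum, extMulComp_wordSum (w := (fun l => N + l) ∘ w) fun i j =>
    (hvN i).trans_le (Nat.le_add_right _ _)]
  refine wordSum_mem_wordSpan (N := N + M) ?_ ?_ ?_
  · exact append_monotone hv (fun i j hij => Nat.add_le_add_left (hw hij) N)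
      fun i j => ((hvN i).trans_le (Nat.le_add_right _ _)).le
  · intro i
    refine Fin.addCases (fun i => ?_) (fun i => ?_) i
    · simpa using (hvN i).trans_le (Nat.le_add_right _ _)
    · simpa using hwM i
  · rw [List.range_add, wordTensors_append hC]
    · refine Submodule.apply_mem_map₂ _ ht ?_
      rwa [wordTensors_map_comp _ _ hinj]
    · simp
    · intro i hi
      obtain ⟨l, _, h⟩ := List.mem_map.1 hi
      have := hvN i
      omega

theorem single_one_mem_wordSpan (hC : ConditionC B) {n : ℕ} {t : ⨂[K]^n A} (ht : t ∈ B n) :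
    SkewMonoidAlgebra.single 1 t ∈ wordSpan B n := by
  rw [← wordSum_const 0]
  refine wordSum_mem_wordSpan (N := 1) monotone_const (fun _ => Nat.one_pos) ?_
  rw [List.range_one, wordTensors_const hC]
  exact ht

/-- Induction on the size of the alphabet: the last letter occupies a final segment, and splitting
it off exhibits the sum as an external product with a generator. -/
theorem wordSum_mem_component (hC : ConditionC B) (N : ℕ) : ∀ {n : ℕ} {w : Fin n → ℕ}
    (_ : Monotone w) (_ : ∀ i, w i < N) {u : ⨂[K]^n A} (_ : u ∈ wordTensors B (List.range N) w),
    wordSum w u ∈ component (descentAlgebra B) n := by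
  induction N with
  | zero =>
    intro n w _ hN u _
    cases n with
    | zero => exact Submodule.sum_mem _ fun π _ => single_zero_mem_component B _ _
    | succ n => exact absurd (hN 0) (Nat.not_lt_zero _)
  | succ N ih =>
    intro n w hw hN u hu
    -- By monotonicity, the positions with letter below `N` are the first `a`; `m`, possibly zero,
    -- counts the letters `N`.
    obtain ⟨a, m, hn, ha⟩ : ∃ a m, n = a + m ∧ ∀ i : Fin n, i.val < a ↔ w i < N := by
      refine ⟨(Finset.univ.filter fun i => w i < N).card,
        n - (Finset.univ.filter fun i => w i < N).card, ?_, fun i => ?_⟩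
      · have := Finset.card_filter_le (Finset.univ : Finset (Fin n)) (fun i => w i < N)
        rw [Finset.card_fin] at this
        omega
      · exact Tuple.lt_card_lt_iff_apply_lt_of_monotone hw
    subst hn
    obtain ⟨v, rfl⟩ : ∃ v : Fin a → ℕ, w = Fin.append v (fun _ : Fin m => N) := by
      refine ⟨fun i => w (Fin.castAdd m i), ?_⟩
      ext i
      refine Fin.addCases (fun i => ?_) (fun i => ?_) i
      · simp
      · have h1 := hN (Fin.natAdd a i)
        have h2 := (ha (Fin.natAdd a i)).not.1 (by simp)
        rw [Fin.append_right]
        omega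
    have hvN : ∀ i, v i < N := fun i => by simpa using (ha (Fin.castAdd m i)).1 (by simp)
    have hv : Monotone v := fun i j hij => by
      simpa using hw ((Fin.strictMono_castAdd m).monotone hij)
    rw [List.range_succ, wordTensors_append hC (by simp)
      (by simpa using fun i => (hvN i).ne), wordTensors_const hC] at hu
    -- Written as a linear map in the tensor, the sum need only be treated for products `x ⊗ y`.
    suffices h : Submodule.map₂ (tensorMul K A a m) (wordTensors B (List.range N) v) (B m) ≤
        (component (descentAlgebra B) (a + m)).comap (∑ π ∈ fiberShuffles
          (Fin.append v fun _ : Fin m => N), sharp K A π ∘ₗ permLin K A π) by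
      have := h hu
      simpa [LinearMap.sum_apply, sharp_apply, permLin_apply, wordSum] using this
    rw [Submodule.map₂_le]
    intro x hx y hy
    have := extMulComp_mem_component B (ih hv hvN hx) (single_one_mem_descentAlgebra hy)
    rw [← wordSum_const N, extMulComp_wordSum fun i _ => hvN i] at this
    simpa [LinearMap.sum_apply, sharp_apply, permLin_apply, wordSum] using this

theorem wordSpan_le_component (hC : ConditionC B) (n : ℕ) :
    wordSpan B n ≤ component (descentAlgebra B) n := by
  rw [wordSpan, Submodule.span_le]
  rintro _ ⟨N, w, hw, hN, u, hu, rfl⟩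
  exact wordSum_mem_component hC N hw hN hu

/-- The right side contains the unit and the generators and is closed under the external product, so
minimality gives one inclusion. The unit lies there because `B 0` is everything. -/
theorem descentAlgebra_eq_iSup (hC : ConditionC B) (h0 : B 0 = ⊤) :
    descentAlgebra B = ⨆ n, (wordSpan B n).map (DirectSum.lof K ℕ (FComp K A) n) := by
  refine le_antisymm (sInf_le ⟨?_, ?_, ?_⟩) (iSup_le fun n => ?_)
  · refine Submodule.mem_iSup_of_mem 0 ⟨_, single_one_mem_wordSpan hC ?_, rfl⟩
    rw [h0]
    exact Submodule.mem_top
  · intro x hx y hy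
    have hle : Submodule.map₂ (extMul K A)
        (⨆ n, (wordSpan B n).map (DirectSum.lof K ℕ (FComp K A) n))
        (⨆ n, (wordSpan B n).map (DirectSum.lof K ℕ (FComp K A) n)) ≤
        ⨆ n, (wordSpan B n).map (DirectSum.lof K ℕ (FComp K A) n) := by
      rw [Submodule.map₂_iSup_left]
      refine iSup_le fun n => ?_
      rw [Submodule.map₂_iSup_right]
      refine iSup_le fun m => ?_
      rw [Submodule.map₂_le]
      rintro _ ⟨a, ha, rfl⟩ _ ⟨b, hb, rfl⟩
      rw [extMul_lof_lof]
      exact Submodule.mem_iSup_of_mem (n + m) ⟨_, extMulComp_mem_wordSpan hC ha hb, rfl⟩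
    exact hle (Submodule.apply_mem_map₂ _ hx hy)
  · intro n t ht
    exact Submodule.mem_iSup_of_mem n ⟨_, single_one_mem_wordSpan hC ht, rfl⟩
  · rw [Submodule.map_le_iff_le_comap]
    exact wordSpan_le_component hC n

theorem apply_mem_wordSpan (hC : ConditionC B) (h0 : B 0 = ⊤) {x : F K A}
    (hx : x ∈ descentAlgebra B) (n : ℕ) : x n ∈ wordSpan B n := by
  classical
  rw [descentAlgebra_eq_iSup hC h0] at hx
  suffices h : ⨆ n, (wordSpan B n).map (DirectSum.lof K ℕ (FComp K A) n) ≤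
      (wordSpan B n).comap (DirectSum.component K ℕ (FComp K A) n) from h hx
  refine iSup_le fun m => ?_
  rintro _ ⟨y, hy, rfl⟩
  rw [Submodule.mem_comap]
  rcases eq_or_ne m n with rfl | h
  · rwa [DirectSum.component.lof_self]
  · rw [DirectSum.component.of, dif_neg h]
    exact Submodule.zero_mem _

theorem component_descentAlgebra (hC : ConditionC B) (h0 : B 0 = ⊤) (n : ℕ) :
    component (descentAlgebra B) n = wordSpan B n := by
  refine le_antisymm (fun x hx => ?_) (wordSpan_le_component hC n)
  have := apply_mem_wordSpan hC h0 hx n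
  rwa [DirectSum.lof_eq_of, DirectSum.of_eq_same] at this

/-- The heart of the proof: grouping the double sum by the word `v ∘ ρ` writes the product as a sum
of spanning elements, one for each such word. -/
theorem wordSum_mul_wordSum_mem (hA : SplitsTwo B) (hB : ConditionB B) (hC : ConditionC B)
    (h0 : B 0 = ⊤) {n N M : ℕ} {v w : Fin n → ℕ} (hv : Monotone v) (hw : Monotone w)
    (hvN : ∀ i, v i < N) (hwM : ∀ i, w i < M) {t s : ⨂[K]^n A}
    (ht : t ∈ wordTensors B (List.range N) v) (hs : s ∈ wordTensors B (List.range M) w) :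
    wordSum v t * wordSum w s ∈ wordSpan B n := by
  classical
  -- Uses `π t · (πρ) s = (πρ)(ρ⁻¹ t · s)`.
  have hexp : wordSum v t * wordSum w s = ∑ p ∈ fiberShuffles v ×ˢ fiberShuffles w,
      (SkewMonoidAlgebra.single (p.1 * p.2) ((p.1 * p.2) • (p.2⁻¹ • t * s)) : FComp K A n) := by
    rw [wordSum, wordSum, Finset.sum_mul_sum, ← Finset.sum_product']
    refine Finset.sum_congr rfl fun p _ => ?_
    rw [sharp_mul_sharp, smul_mul', ← mul_smul, ← mul_smul, mul_inv_cancel_right]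
  rw [hexp, ← Finset.sum_fiberwise_of_maps_to
    (t := (fiberShuffles w).image fun ρ : Equiv.Perm (Fin n) => v ∘ ρ)
    (g := fun p : Equiv.Perm (Fin n) × Equiv.Perm (Fin n) => v ∘ p.2) fun p hp =>
      Finset.mem_image_of_mem _ (Finset.mem_product.1 hp).2]
  refine Submodule.sum_mem _ fun r hr => ?_
  obtain ⟨ρ₀, hρ₀, rfl⟩ := Finset.mem_image.1 hr
  have hcongr : ∀ ρ : Equiv.Perm (Fin n), v ∘ ρ = v ∘ ρ₀ → ρ⁻¹ • t = ρ₀⁻¹ • t := by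
    intro ρ hρ
    -- `ρ₀ρ⁻¹` lies in the Young subgroup of `v`, hence fixes `t`.
    have h1 : v ∘ ⇑(ρ₀ * ρ⁻¹) = v := by
      ext i
      have := congrFun hρ (ρ⁻¹ i)
      simp only [Function.comp, Equiv.Perm.mul_apply] at this ⊢
      rw [← this]
      simp
    have h2 := smul_eq_of_mem_wordTensors hC h1 ht
    rw [mul_smul] at h2
    conv_rhs => rw [← h2, inv_smul_smul]
  rw [Finset.sum_congr rfl fun p hp => by rw [hcongr p.2 (Finset.mem_filter.1 hp).2],
    sum_fiberShuffles_mul hv hvN hρ₀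
      (fun τ => (SkewMonoidAlgebra.single τ (τ • (ρ₀⁻¹ • t * s)) : FComp K A n))]
  refine wordSum_mem_wordSpan (N := N * M) (pairWord_monotone hv hw hvN hρ₀)
    (pairWord_lt (fun i => hvN _) hwM) ?_
  refine wordTensors_mul_self hB _ List.nodup_range (Submodule.mul_mem_mul ?_ ?_)
  -- The pair word refines `v ∘ ρ₀` by taking remainders modulo `N`, and below it refines `w` by
  -- taking quotients.
  · refine wordTensors_le hA hC h0 List.nodup_range List.nodup_range (· % N)
      (pairWord_mod fun i => hvN _) (fun j hj => ?_) (fun i => ?_) (smul_mem_wordTensors hC ρ₀ ht)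
    · rw [List.mem_range] at hj ⊢
      exact Nat.mod_lt _ (Nat.pos_of_ne_zero fun h => by simp [h] at hj)
    · exact List.mem_range.2 (pairWord_lt (fun i => hvN _) hwM i)
  · refine wordTensors_le hA hC h0 List.nodup_range List.nodup_range (· / N)
      (pairWord_div fun i => hvN _) (fun j hj => ?_) (fun i => ?_) hs
    · rw [List.mem_range] at hj ⊢
      exact Nat.div_lt_of_lt_mul hj
    · exact List.mem_range.2 (pairWord_lt (fun i => hvN _) hwM i)

theorem smul_mul_eq {n : ℕ} (r : K) (x y : FComp K A n) : (r • x) * y = r • (x * y) := by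
  induction x using SkewMonoidAlgebra.induction_on with
  | zero => simp
  | add x x' hx hx' => rw [smul_add, add_mul, hx, hx', add_mul, smul_add]
  | single σ a =>
    induction y using SkewMonoidAlgebra.induction_on with
    | zero => simp
    | add y y' hy hy' => rw [mul_add, hy, hy', mul_add, smul_add]
    | single τ b =>
      rw [SkewMonoidAlgebra.smul_single, sharp_mul_sharp, sharp_mul_sharp,
        SkewMonoidAlgebra.smul_single, smul_mul_assoc]

theorem mul_smul_eq {n : ℕ} (r : K) (x y : FComp K A n) : x * (r • y) = r • (x * y) := by
  induction x using SkewMonoidAlgebra.induction_on with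
  | zero => simp
  | add x x' hx hx' => rw [add_mul, hx, hx', add_mul, smul_add]
  | single σ a =>
    induction y using SkewMonoidAlgebra.induction_on with
    | zero => simp
    | add y y' hy hy' => rw [smul_add, mul_add, hy, hy', mul_add, smul_add]
    | single τ b =>
      rw [SkewMonoidAlgebra.smul_single, sharp_mul_sharp, sharp_mul_sharp,
        SkewMonoidAlgebra.smul_single, ← permLin_apply, map_smul, mul_smul_comm, permLin_apply]

theorem mul_mem_wordSpan (hA : SplitsTwo B) (hB : ConditionB B) (hC : ConditionC B)
    (h0 : B 0 = ⊤) {n : ℕ} {x y : FComp K A n} (hx : x ∈ wordSpan B n) (hy : y ∈ wordSpan B n) :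
    x * y ∈ wordSpan B n := by
  refine Submodule.span_induction (p := fun x _ => x * y ∈ wordSpan B n) ?_ ?_ ?_ ?_ hx
  · rintro _ ⟨N, v, hv, hvN, t, ht, rfl⟩
    refine Submodule.span_induction (p := fun y _ => wordSum v t * y ∈ wordSpan B n)
      ?_ ?_ ?_ ?_ hy
    · rintro _ ⟨M, w, hw, hwM, s, hs, rfl⟩
      exact wordSum_mul_wordSum_mem hA hB hC h0 hv hw hvN hwM ht hs
    · rw [mul_zero]
      exact Submodule.zero_mem _
    · intro y y' _ _ h h'
      rw [mul_add]
      exact Submodule.add_mem _ h h'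
    · intro r y _ h
      rw [mul_smul_eq]
      exact Submodule.smul_mem _ r h
  · rw [zero_mul]
    exact Submodule.zero_mem _
  · intro x x' _ _ h h'
    rw [add_mul]
    exact Submodule.add_mem _ h h'
  · intro r x _ h
    rw [smul_mul_eq]
    exact Submodule.smul_mem _ r h

theorem isInternalSubalgebra_of_splitsTwo (hA : SplitsTwo B) (hB : ConditionB B)
    (hC : ConditionC B) : IsInternalSubalgebra (descentAlgebra B) := by
  -- Enlarging `B 0` to all of `A^{⊗0}` changes neither the descent algebra nor the three
  -- conditions, and makes unused letters harmless.
  set B' : (n : ℕ) → Submodule K (⨂[K]^n A) := fun n => if n = 0 then ⊤ else B n with hB'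
  have hpos : ∀ n, 0 < n → B n = B' n := fun n hn => (if_neg hn.ne').symm
  have h0 : B' 0 = ⊤ := if_pos rfl
  have hA' : SplitsTwo B' := by
    intro n m hn hm
    rw [← hpos n hn, ← hpos m hm, ← hpos (n + m) (by omega)]
    exact hA n m hn hm
  have hB'' : ConditionB B' := by
    intro n x hx y hy
    rcases n.eq_zero_or_pos with rfl | hn
    · rw [h0]; exact Submodule.mem_top
    · rw [← hpos n hn] at *
      exact hB n x hx y hy
  have hC' : ConditionC B' := by
    intro n
    rcases n.eq_zero_or_pos with rfl | hn
    · intro x _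
      rw [mem_symTensors]
      intro π
      rw [Subsingleton.elim π 1, one_smul]
    · rw [← hpos n hn]
      exact hC n
  rw [descentAlgebra_congr hpos]
  constructor
  · intro x hx n
    rw [component_descentAlgebra hC' h0]
    exact apply_mem_wordSpan hC' h0 hx n
  · intro n x hx y hy
    rw [component_descentAlgebra hC' h0] at *
    exact mul_mem_wordSpan hA' hB'' hC' h0 hx hy

end Algebra

/-! ### Symmetric tensors on free modules -/

section FreeModule

variable {K : Type u} [CommRing K] {V : Type v} [AddCommGroup V] [Module K V] {ι : Type*}

/-- The basis of `V^{⊗n}` induced by a basis of `V`. -/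
def wordBasis (b : Module.Basis ι K V) (n : ℕ) : Module.Basis (Fin n → ι) K (⨂[K]^n V) :=
  Basis.piTensorProduct fun _ => b

theorem wordBasis_repr_tprod (b : Module.Basis ι K V) {n : ℕ} (a : Fin n → V) (p : Fin n → ι) :
    (wordBasis b n).repr (PiTensorProduct.tprod K a) p = ∏ i, b.repr (a i) (p i) :=
  Basis.piTensorProduct_repr_tprod_apply _ _ _

theorem wordBasis_repr_smul (b : Module.Basis ι K V) {n : ℕ} (σ : Equiv.Perm (Fin n))
    (t : ⨂[K]^n V) (p : Fin n → ι) :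
    (wordBasis b n).repr (σ • t) p = (wordBasis b n).repr t (p ∘ σ) := by
  suffices h : (wordBasis b n).coord p ∘ₗ permLin K V σ = (wordBasis b n).coord (p ∘ σ) from
    LinearMap.congr_fun h t
  ext a
  simp only [LinearMap.compMultilinearMap_apply, LinearMap.comp_apply, permLin_apply,
    perm_smul_tprod, Module.Basis.coord_apply, wordBasis_repr_tprod]
  rw [← Equiv.prod_comp σ]
  refine Finset.prod_congr rfl fun i _ => ?_
  have h : σ⁻¹ (σ i) = i := σ.symm_apply_apply i
  rw [h]
  rfl

theorem wordBasis_repr_tensorMul (b : Module.Basis ι K V) {n m : ℕ} (x : ⨂[K]^n V)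
    (y : ⨂[K]^m V) (p : Fin n → ι) (q : Fin m → ι) :
    (wordBasis b (n + m)).repr (tensorMul K V n m x y) (Fin.append p q) =
      (wordBasis b n).repr x p * (wordBasis b m).repr y q := by
  suffices h : (tensorMul K V n m).compr₂ ((wordBasis b (n + m)).coord (Fin.append p q)) =
      (LinearMap.mul K K).compl₁₂ ((wordBasis b n).coord p) ((wordBasis b m).coord q) from
    LinearMap.congr_fun₂ h x y
  ext a c
  simp only [LinearMap.compMultilinearMap_apply, LinearMap.compr₂_apply, LinearMap.compl₁₂_apply,
    LinearMap.mul_apply', tensorMul_tprod, Module.Basis.coord_apply, wordBasis_repr_tprod]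
  rw [Fin.prod_univ_add]
  simp

open Classical in
/-- The sum of the distinct rearrangements of a basis word. -/
def orbitSum (b : Module.Basis ι K V) {n : ℕ} (p : Fin n → ι) : ⨂[K]^n V :=
  ∑ r ∈ Finset.univ.image fun σ : Equiv.Perm (Fin n) => p ∘ σ, wordBasis b n r

open Classical in
theorem wordBasis_repr_orbitSum (b : Module.Basis ι K V) {n : ℕ} (p r : Fin n → ι) :
    (wordBasis b n).repr (orbitSum b p) r =
      if ∃ σ : Equiv.Perm (Fin n), p ∘ σ = r then 1 else 0 := by
  simp [orbitSum, Finsupp.single_apply, Finsupp.finsetSum_apply]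

theorem orbitSum_mem_symTensors (b : Module.Basis ι K V) {n : ℕ} (p : Fin n → ι) :
    orbitSum b p ∈ symTensors K V n := by
  classical
  rw [mem_symTensors]
  intro τ
  refine (wordBasis b n).ext_elem fun r => ?_
  rw [wordBasis_repr_smul, wordBasis_repr_orbitSum, wordBasis_repr_orbitSum]
  congr 1
  rw [eq_iff_iff]
  constructor
  · rintro ⟨σ, h⟩
    refine ⟨σ * τ⁻¹, ?_⟩
    ext i
    have := congrFun h (τ⁻¹ i)
    simpa using this
  · rintro ⟨σ, rfl⟩
    exact ⟨σ * τ, rfl⟩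

/-- The coefficients of `t` are constant on orbits of `𝔖ₙ × 𝔖ₘ`, so subtracting a multiple of a
product of two orbit sums removes a whole orbit from the support. Invariance is assumed only under
this subgroup because the remainder need not be symmetric under all of `𝔖ₙ₊ₘ`. -/
theorem mem_map₂_symTensors_of_invariant (b : Module.Basis ι K V) {n m : ℕ} (t : ⨂[K]^(n + m) V)
    (ht : ∀ (σ : Equiv.Perm (Fin n)) (σ' : Equiv.Perm (Fin m)), permProd σ σ' • t = t) :
    t ∈ Submodule.map₂ (tensorMul K V n m) (symTensors K V n) (symTensors K V m) := by
  classical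
  obtain ⟨k, hk⟩ : ∃ k, ((wordBasis b (n + m)).repr t).support.card = k := ⟨_, rfl⟩
  induction k using Nat.strong_induction_on generalizing t with
  | _ k ih =>
    rcases ((wordBasis b (n + m)).repr t).support.eq_empty_or_nonempty with h | ⟨r, hr⟩
    · rw [Finsupp.support_eq_empty, LinearEquiv.map_eq_zero_iff] at h
      rw [h]
      exact Submodule.zero_mem _
    obtain ⟨p, q, rfl⟩ : ∃ p q, r = Fin.append p q := ⟨_, _, (Fin.append_castAdd_natAdd).symm⟩
    have hinv : ∀ (σ : Equiv.Perm (Fin n)) (σ' : Equiv.Perm (Fin m)),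
        (wordBasis b (n + m)).repr t (Fin.append (p ∘ σ) (q ∘ σ')) =
          (wordBasis b (n + m)).repr t (Fin.append p q) := by
      intro σ σ'
      conv_rhs => rw [← ht σ σ', wordBasis_repr_smul]
      congr 1
      ext i
      refine Fin.addCases (fun i => ?_) (fun i => ?_) i <;> simp
    set c := (wordBasis b (n + m)).repr t (Fin.append p q) with hc
    set s := c • tensorMul K V n m (orbitSum b p) (orbitSum b q) with hs
    have hsm : s ∈ Submodule.map₂ (tensorMul K V n m) (symTensors K V n) (symTensors K V m) :=
      Submodule.smul_mem _ _ (Submodule.apply_mem_map₂ _ (orbitSum_mem_symTensors b p)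
        (orbitSum_mem_symTensors b q))
    have hrepr : ∀ p' q', (wordBasis b (n + m)).repr (t - s) (Fin.append p' q') =
        if (∃ σ : Equiv.Perm (Fin n), p ∘ σ = p') ∧ (∃ σ : Equiv.Perm (Fin m), q ∘ σ = q') then 0
        else (wordBasis b (n + m)).repr t (Fin.append p' q') := by
      intro p' q'
      rw [map_sub, Finsupp.sub_apply, hs, map_smul, Finsupp.smul_apply, wordBasis_repr_tensorMul,
        wordBasis_repr_orbitSum, wordBasis_repr_orbitSum]
      by_cases h1 : ∃ σ : Equiv.Perm (Fin n), p ∘ σ = p'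
      · by_cases h2 : ∃ σ : Equiv.Perm (Fin m), q ∘ σ = q'
        · rw [if_pos h1, if_pos h2, if_pos ⟨h1, h2⟩]
          obtain ⟨σ, rfl⟩ := h1
          obtain ⟨σ', rfl⟩ := h2
          rw [hinv]
          simp
        · simp [h2]
      · simp [h1]
    have hsub : ((wordBasis b (n + m)).repr (t - s)).support ⊂
        ((wordBasis b (n + m)).repr t).support := by
      rw [Finset.ssubset_iff_of_subset]
      · refine ⟨_, hr, ?_⟩
        rw [Finsupp.notMem_support_iff, hrepr, if_pos ⟨⟨1, rfl⟩, ⟨1, rfl⟩⟩]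
      · intro r'
        obtain ⟨p', q', rfl⟩ : ∃ p q, r' = Fin.append p q :=
          ⟨_, _, (Fin.append_castAdd_natAdd).symm⟩
        rw [Finsupp.mem_support_iff, Finsupp.mem_support_iff, hrepr]
        intro h h'
        rw [h'] at h
        simp at h
    have := ih _ (hk ▸ Finset.card_lt_card hsub) (t - s) (fun σ σ' => ?_) rfl
    · simpa using Submodule.add_mem _ this hsm
    · rw [smul_sub, ht, hs, ← permLin_apply, map_smul, permLin_apply, permProd_smul_tensorMul,
        mem_symTensors.1 (orbitSum_mem_symTensors b p),
        mem_symTensors.1 (orbitSum_mem_symTensors b q)]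

theorem splitsTwo_symTensors_of_basis (b : Module.Basis ι K V) : SplitsTwo (symTensors K V) := by
  intro n m _ _ t ht
  exact mem_map₂_symTensors_of_invariant b t fun _ _ => mem_symTensors.1 ht _

end FreeModule

/-! ### Symmetric tensors on projective modules -/

section Projective

variable {K : Type u} [CommRing K]

section Functoriality

variable {V W : Type*} [AddCommGroup V] [Module K V] [AddCommGroup W] [Module K W]

/-- The map `f^{⊗n}`. -/
def tensorMap (n : ℕ) (f : V →ₗ[K] W) : ⨂[K]^n V →ₗ[K] ⨂[K]^n W :=
  PiTensorProduct.map fun _ => f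

theorem tensorMap_tprod {n : ℕ} (f : V →ₗ[K] W) (a : Fin n → V) :
    tensorMap n f (PiTensorProduct.tprod K a) = PiTensorProduct.tprod K fun i => f (a i) :=
  PiTensorProduct.map_tprod _ _

theorem tensorMap_smul {n : ℕ} (f : V →ₗ[K] W) (σ : Equiv.Perm (Fin n)) (t : ⨂[K]^n V) :
    tensorMap n f (σ • t) = σ • tensorMap n f t := by
  suffices h : tensorMap n f ∘ₗ permLin K V σ = permLin K W σ ∘ₗ tensorMap n f from
    LinearMap.congr_fun h t
  ext a
  simp only [LinearMap.compMultilinearMap_apply, LinearMap.comp_apply, permLin_apply,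
    perm_smul_tprod, tensorMap_tprod]

theorem tensorMap_mem_symTensors {n : ℕ} (f : V →ₗ[K] W) {t : ⨂[K]^n V}
    (ht : t ∈ symTensors K V n) : tensorMap n f t ∈ symTensors K W n := by
  rw [mem_symTensors] at *
  intro π
  rw [← tensorMap_smul, ht]

theorem tensorMap_tensorMul {n m : ℕ} (f : V →ₗ[K] W) (x : ⨂[K]^n V) (y : ⨂[K]^m V) :
    tensorMap (n + m) f (tensorMul K V n m x y) =
      tensorMul K W n m (tensorMap n f x) (tensorMap m f y) := by
  suffices h : (tensorMul K V n m).compr₂ (tensorMap (n + m) f) =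
      (tensorMul K W n m).compl₁₂ (tensorMap n f) (tensorMap m f) from
    LinearMap.congr_fun₂ h x y
  ext a c
  simp only [LinearMap.compMultilinearMap_apply, LinearMap.compr₂_apply, LinearMap.compl₁₂_apply,
    tensorMul_tprod, tensorMap_tprod]
  congr 1
  ext i
  refine Fin.addCases (fun i => ?_) (fun i => ?_) i <;> simp

theorem tensorMap_tensorMap_of_comp_eq_id {n : ℕ} {f : V →ₗ[K] W} {g : W →ₗ[K] V}
    (h : g ∘ₗ f = LinearMap.id) (t : ⨂[K]^n V) : tensorMap n g (tensorMap n f t) = t := by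
  suffices h : tensorMap n g ∘ₗ tensorMap n f = LinearMap.id from LinearMap.congr_fun h t
  ext a
  simp only [LinearMap.compMultilinearMap_apply, LinearMap.comp_apply, tensorMap_tprod,
    LinearMap.id_apply]
  congr 1
  ext i
  exact LinearMap.congr_fun h (a i)

end Functoriality

/-- A projective module is a retract of a free one: lift `t` by the section, split it there, and
project the factors, which stay symmetric. -/
theorem splitsTwo_symTensors (A : Type v) [AddCommGroup A] [Module K A] [Module.Projective K A] :
    SplitsTwo (symTensors K A) := by
  obtain ⟨s, hs⟩ := Module.projective_def'.1 (inferInstance : Module.Projective K A)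
  intro n m hn hm t ht
  have h := splitsTwo_symTensors_of_basis (Finsupp.basisSingleOne (R := K) (ι := A)) n m hn hm
    (tensorMap_mem_symTensors s ht)
  have hle : Submodule.map₂ (tensorMul K (A →₀ K) n m) (symTensors K (A →₀ K) n)
      (symTensors K (A →₀ K) m) ≤
      (Submodule.map₂ (tensorMul K A n m) (symTensors K A n) (symTensors K A m)).comap
        (tensorMap (n + m) (Finsupp.linearCombination K id)) := by
    rw [Submodule.map₂_le]
    intro x hx y hy
    rw [Submodule.mem_comap, tensorMap_tensorMul]
    exact Submodule.apply_mem_map₂ _ (tensorMap_mem_symTensors _ hx)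
      (tensorMap_mem_symTensors _ hy)
  have := hle h
  rwa [Submodule.mem_comap, tensorMap_tensorMap_of_comp_eq_id hs] at this

theorem conditionB_symTensors (A : Type v) [Ring A] [Algebra K A] :
    ConditionB (symTensors K A) := by
  intro n x hx y hy
  rw [mem_symTensors] at *
  intro π
  rw [smul_mul', hx, hy]

theorem one_mem_symTensors (A : Type v) [Ring A] [Algebra K A] (n : ℕ) :
    (1 : ⨂[K]^n A) ∈ symTensors K A n :=
  mem_symTensors.2 fun π => smul_one π

end Projective

/-! ### Iterated coproducts -/

section Coalgebra

variable {K : Type u} [CommRing K] {C : Type v} [AddCommGroup C] [Module K C]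

theorem tensorMul_assoc {n m k : ℕ} (x : ⨂[K]^n C) (y : ⨂[K]^m C) (z : ⨂[K]^k C) :
    TensorPower.cast K C (add_assoc n m k)
      (tensorMul K C (n + m) k (tensorMul K C n m x y) z) =
      tensorMul K C n (m + k) x (tensorMul K C m k y z) :=
  TensorPower.mul_assoc x y z

variable (K C) in
/-- The identification `C ≃ C^{⊗1}`. -/
def toPowerOne : C →ₗ[K] ⨂[K]^1 C :=
  (PiTensorProduct.subsingletonEquiv (R := K) (s := fun _ => C) (0 : Fin 1)).symm.toLinearMap

theorem toPowerOne_apply (x : C) :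
    toPowerOne K C x = PiTensorProduct.tprod K (fun _ : Fin 1 => x) :=
  PiTensorProduct.subsingletonEquiv_symm_apply' (R := K) (0 : Fin 1) x

/-- The map `x ⊗ y ↦ f(x) g(y)`. -/
def tensorMulMap {X Y : Type*} [AddCommGroup X] [Module K X] [AddCommGroup Y] [Module K Y]
    {n m : ℕ} (f : X →ₗ[K] ⨂[K]^n C) (g : Y →ₗ[K] ⨂[K]^m C) : X ⊗[K] Y →ₗ[K] ⨂[K]^(n + m) C :=
  TensorProduct.lift ((tensorMul K C n m).compl₁₂ f g)

theorem tensorMulMap_tmul {X Y : Type*} [AddCommGroup X] [Module K X] [AddCommGroup Y]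
    [Module K Y] {n m : ℕ} (f : X →ₗ[K] ⨂[K]^n C) (g : Y →ₗ[K] ⨂[K]^m C) (x : X) (y : Y) :
    tensorMulMap f g (x ⊗ₜ y) = tensorMul K C n m (f x) (g y) := rfl

theorem permProd_smul_tensorMulMap {n m : ℕ} {f : C →ₗ[K] ⨂[K]^n C} {g : C →ₗ[K] ⨂[K]^m C}
    {σ : Equiv.Perm (Fin n)} {σ' : Equiv.Perm (Fin m)} (hf : ∀ x, σ • f x = f x)
    (hg : ∀ x, σ' • g x = g x) (z : C ⊗[K] C) :
    permProd σ σ' • tensorMulMap f g z = tensorMulMap f g z := by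
  induction z using TensorProduct.induction_on with
  | zero => simp
  | add y z hy hz => rw [map_add, smul_add, hy, hz]
  | tmul y z => rw [tensorMulMap_tmul, permProd_smul_tensorMul, hf, hg]

variable [Coalgebra K C]

theorem iterComul_zero (x : C) :
    iterComul K C 0 x = TensorPower.algebraMap₀ (Coalgebra.counit (R := K) x) := rfl

theorem iterComul_succ (n : ℕ) (x : C) : iterComul K C (n + 1) x =
    tensorMulMap (iterComul K C n) (toPowerOne K C) (Coalgebra.comul x) := by
  suffices h : iterComul K C (n + 1) =
      tensorMulMap (iterComul K C n) (toPowerOne K C) ∘ₗ Coalgebra.comul from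
    LinearMap.congr_fun h x
  rw [iterComul, ← LinearMap.comp_assoc]
  congr 1
  ext y z
  rfl

/-- Generalized coassociativity, by induction on `m`: the counit law starts it and coassociativity
moves the last factor. It gives the splitting condition for the images of the iterated coproducts.
-/
theorem iterComul_add (n m : ℕ) (x : C) : iterComul K C (n + m) x =
    tensorMulMap (iterComul K C n) (iterComul K C m) (Coalgebra.comul x) := by
  induction m generalizing x with
  | zero =>
    have h : tensorMulMap (iterComul K C n) (iterComul K C 0) =
        iterComul K C n ∘ₗ (TensorProduct.rid K C).toLinearMap ∘ₗ
          (Coalgebra.counit (R := K) (A := C)).lTensor C := by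
      ext y z
      change tensorMul K C n 0 (iterComul K C n y)
        (TensorPower.algebraMap₀ (Coalgebra.counit (R := K) z)) = _
      have := TensorPower.mul_algebraMap₀ (Coalgebra.counit (R := K) z) (iterComul K C n y)
      rw [TensorPower.cast_refl] at this
      refine this.trans ?_
      simp
    rw [h]
    simp
  | succ m ih =>
    have h1 : tensorMulMap (iterComul K C (n + m)) (toPowerOne K C) =
        tensorMulMap (tensorMulMap (iterComul K C n) (iterComul K C m)) (toPowerOne K C) ∘ₗ
          (Coalgebra.comul (R := K) (A := C)).rTensor C := by
      ext y z
      simp [tensorMulMap_tmul, ih]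
    have h2 : tensorMulMap (iterComul K C n) (iterComul K C (m + 1)) =
        tensorMulMap (iterComul K C n) (tensorMulMap (iterComul K C m) (toPowerOne K C)) ∘ₗ
          (Coalgebra.comul (R := K) (A := C)).lTensor C := by
      ext y z
      simp [tensorMulMap_tmul, iterComul_succ]
    have h3 : (TensorPower.cast K C (add_assoc n m 1)).toLinearMap ∘ₗ
        tensorMulMap (tensorMulMap (iterComul K C n) (iterComul K C m)) (toPowerOne K C) =
        tensorMulMap (iterComul K C n) (tensorMulMap (iterComul K C m) (toPowerOne K C)) ∘ₗ
          (TensorProduct.assoc K C C C).toLinearMap := by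
      refine TensorProduct.ext_threefold fun a b c => ?_
      simp only [LinearMap.comp_apply, LinearEquiv.coe_coe, tensorMulMap_tmul,
        TensorProduct.assoc_tmul]
      exact tensorMul_assoc _ _ _
    have h4 : iterComul K C (n + m + 1) x = _ := iterComul_succ (n + m) x
    -- The degrees `n + m + 1` and `n + (m + 1)` agree definitionally, so the cast is trivial.
    rw [TensorPower.cast_refl] at h3
    rw [h2, LinearMap.comp_apply, ← Coalgebra.coassoc_apply]
    refine h4.trans ?_
    rw [h1]
    exact LinearMap.congr_fun h3 _

theorem splitsTwo_iterComul : SplitsTwo fun n => LinearMap.range (iterComul K C n) := by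
  rintro n m - - _ ⟨x, rfl⟩
  rw [iterComul_add]
  induction Coalgebra.comul (R := K) x using TensorProduct.induction_on with
  | zero => simp
  | add y z hy hz => rw [map_add]; exact Submodule.add_mem _ hy hz
  | tmul y z => exact Submodule.apply_mem_map₂ _ ⟨y, rfl⟩ ⟨z, rfl⟩

theorem iterComul_one (x : C) : iterComul K C 1 x = PiTensorProduct.tprod K fun _ => x := by
  have h : tensorMulMap (iterComul K C 0) (toPowerOne K C) =
      toPowerOne K C ∘ₗ (TensorProduct.lid K C).toLinearMap ∘ₗ
        (Coalgebra.counit (R := K) (A := C)).rTensor C := by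
    ext y z
    have := TensorPower.algebraMap₀_mul (Coalgebra.counit (R := K) y) (toPowerOne K C z)
    rw [TensorPower.cast_refl] at this
    refine this.trans ?_
    simp
  have h' := iterComul_succ (K := K) 0 x
  rw [h] at h'
  refine h'.trans ?_
  simp [toPowerOne_apply]

variable [Coalgebra.IsCocomm K C]

theorem swap_smul_iterComul_two (x : C) :
    Equiv.swap (0 : Fin 2) 1 • iterComul K C 2 x = iterComul K C 2 x := by
  have h : permLin K C (Equiv.swap (0 : Fin 2) 1) ∘ₗ
      tensorMulMap (iterComul K C 1) (iterComul K C 1) =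
      tensorMulMap (iterComul K C 1) (iterComul K C 1) ∘ₗ
        (TensorProduct.comm K C C).toLinearMap := by
    ext y z
    simp only [TensorProduct.AlgebraTensorModule.curry_apply, TensorProduct.curry_apply,
      LinearMap.coe_restrictScalars, LinearMap.comp_apply, LinearEquiv.coe_coe,
      TensorProduct.comm_tmul, tensorMulMap_tmul, iterComul_one, tensorMul_tprod, permLin_apply]
    have hyz : tensorMulMap (iterComul K C 1) (iterComul K C 1) (y ⊗ₜ[K] z) =
        PiTensorProduct.tprod K (Fin.append (fun _ : Fin 1 => y) fun _ : Fin 1 => z) := by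
      rw [tensorMulMap_tmul, iterComul_one, iterComul_one, tensorMul_tprod]
    rw [hyz]
    refine (perm_smul_tprod (K := K) (V := C) (Equiv.swap (0 : Fin 2) 1) _).trans ?_
    congr 1
    ext i
    fin_cases i <;> rfl
  have h2 : iterComul K C 2 x =
    tensorMulMap (iterComul K C 1) (iterComul K C 1) (Coalgebra.comul x) := iterComul_add 1 1 x
  rw [h2]
  refine (LinearMap.congr_fun h (Coalgebra.comul x)).trans ?_
  rw [LinearMap.comp_apply, LinearEquiv.coe_coe, Coalgebra.comm_comul]

/-- Cutting the iterated coproduct into pieces of sizes `i`, `2` and `k` makes the adjacent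
transposition act on the middle piece alone, where cocommutativity applies. Such transpositions
generate the symmetric group. -/
theorem swap_smul_iterComul {N : ℕ} (p q : Fin N) (hpq : q.val = p.val + 1) (x : C) :
    Equiv.swap p q • iterComul K C N x = iterComul K C N x := by
  obtain ⟨i, hi⟩ : ∃ i, p.val = i := ⟨_, rfl⟩
  obtain ⟨k, rfl⟩ : ∃ k, N = i + (2 + k) := ⟨N - (i + 2), by have := q.isLt; omega⟩
  have h : Equiv.swap p q = permProd 1 (permProd (Equiv.swap (0 : Fin 2) 1) 1) := by
    obtain rfl : p = Fin.natAdd i (Fin.castAdd k 0) := Fin.ext (by simp [hi])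
    obtain rfl : q = Fin.natAdd i (Fin.castAdd k 1) := Fin.ext (by simp [hpq])
    ext r
    refine Fin.addCases (fun r => ?_) (fun r => ?_) r
    · rw [permProd_castAdd, Equiv.swap_apply_of_ne_of_ne]
      · rfl
      · exact (castAdd_ne_natAdd _ _)
      · exact (castAdd_ne_natAdd _ _)
    · rw [permProd_natAdd]
      refine Fin.addCases (fun r => ?_) (fun r => ?_) r
      · rw [permProd_castAdd]
        fin_cases r <;> simp
      · rw [permProd_natAdd, Equiv.swap_apply_of_ne_of_ne]
        · rfl
        · exact fun h => castAdd_ne_natAdd _ _ (Fin.natAdd_injective _ _ h).symm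
        · exact fun h => castAdd_ne_natAdd _ _ (Fin.natAdd_injective _ _ h).symm
  rw [h, iterComul_add]
  refine permProd_smul_tensorMulMap (fun y => one_smul _ _) (fun y => ?_) _
  rw [iterComul_add]
  exact permProd_smul_tensorMulMap swap_smul_iterComul_two (fun y => one_smul _ _) _

theorem conditionC_iterComul : ConditionC fun n => LinearMap.range (iterComul K C n) := by
  rintro n _ ⟨x, rfl⟩
  rw [mem_symTensors]
  intro π
  cases n with
  | zero => rw [Subsingleton.elim π 1, one_smul]
  | succ n =>
    have hle : (⊤ : Submonoid (Equiv.Perm (Fin (n + 1)))) ≤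
        MulAction.stabilizerSubmonoid _ (iterComul K C (n + 1) x) := by
      rw [← Equiv.Perm.mclosure_swap_castSucc_succ, Submonoid.closure_le]
      rintro _ ⟨i, rfl⟩
      exact swap_smul_iterComul _ _ (by simp) x
    exact hle (Submonoid.mem_top π)

end Coalgebra

/-! ### Multiplicativity of the iterated coproducts -/

section Bialgebra

variable {K : Type u} [CommRing K] {A : Type v} [Ring A]

/-- The second insertion of each pair occupies places disjoint from the first of the other, so the
middle factors can be exchanged. -/
theorem tensorMul_mul [Algebra K A] {n m : ℕ} (x x' : ⨂[K]^n A) (y y' : ⨂[K]^m A) :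
    tensorMul K A n m (x * x') (y * y') =
      tensorMul K A n m x y * tensorMul K A n m x' y' := by
  rw [tensorMul_eq_insertion_mul, tensorMul_eq_insertion_mul, tensorMul_eq_insertion_mul,
    insertion_mul, insertion_mul]
  exact (insertion_commute castAdd_ne_natAdd x' y).mul_mul_mul_comm _ _

theorem tensorMul_one [Algebra K A] {n m : ℕ} :
    tensorMul K A n m (1 : ⨂[K]^n A) (1 : ⨂[K]^m A) = 1 := by
  rw [tensorMul_eq_insertion_mul, insertion_one, insertion_one, mul_one]

variable [Bialgebra K A]

theorem iterComul_mul (n : ℕ) (x y : A) :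
    iterComul K A n (x * y) = iterComul K A n x * iterComul K A n y := by
  induction n generalizing x y with
  | zero =>
    have h : ∀ r : K, (TensorPower.algebraMap₀ r : ⨂[K]^0 A) = algebraMap K _ r := by
      intro r
      rw [TensorPower.algebraMap₀_eq_smul_one, Algebra.algebraMap_eq_smul_one,
        TensorPower.gOne_def, PiTensorProduct.one_def]
      exact congrArg (fun a => r • PiTensorProduct.tprod K a) (Subsingleton.elim _ _)
    rw [iterComul_zero, iterComul_zero, iterComul_zero, h, h, h, Bialgebra.counit_mul, map_mul]
  | succ n ih =>
    have key : ∀ z w : A ⊗[K] A, tensorMulMap (iterComul K A n) (toPowerOne K A) (z * w) =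
        tensorMulMap (iterComul K A n) (toPowerOne K A) z *
          tensorMulMap (iterComul K A n) (toPowerOne K A) w := by
      intro z w
      induction z using TensorProduct.induction_on with
      | zero => simp
      | add z z' hz hz' => rw [add_mul, map_add, hz, hz', map_add, add_mul]
      | tmul a a' =>
        induction w using TensorProduct.induction_on with
        | zero => simp
        | add w w' hw hw' => rw [mul_add, map_add, hw, hw', map_add, mul_add]
        | tmul b b' =>
          rw [Algebra.TensorProduct.tmul_mul_tmul, tensorMulMap_tmul, tensorMulMap_tmul,
            tensorMulMap_tmul, ih, ← tensorMul_mul]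
          congr 1
          simp only [toPowerOne_apply, PiTensorProduct.tprod_mul_tprod]
          rfl
    rw [iterComul_succ, iterComul_succ, iterComul_succ, Bialgebra.comul_mul, key]

theorem iterComul_map_one (n : ℕ) : iterComul K A n 1 = 1 := by
  induction n with
  | zero =>
    rw [iterComul_zero, Bialgebra.counit_one, TensorPower.algebraMap₀_one, TensorPower.gOne_def,
      PiTensorProduct.one_def]
    exact congrArg (PiTensorProduct.tprod K) (Subsingleton.elim _ _)
  | succ n ih =>
    rw [iterComul_succ, Bialgebra.comul_one, Algebra.TensorProduct.one_def, tensorMulMap_tmul, ih,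
      toPowerOne_apply]
    exact tensorMul_one

theorem conditionB_iterComul : ConditionB fun n => LinearMap.range (iterComul K A n) := by
  rintro n _ ⟨x, rfl⟩ _ ⟨y, rfl⟩
  exact ⟨x * y, iterComul_mul n x y⟩

end Bialgebra

end FreeQSym

end

theorem mainTheorem6 (K : Type*) [CommRing K] :
    (∀ (A : Type*) [Ring A] [Algebra K A] [Module.Projective K A]
      (B : (n : ℕ) → Submodule K (PiTensorProduct K fun _ : Fin n => A)),
      FreeQSym.ConditionA B → FreeQSym.ConditionB B → FreeQSym.ConditionC B →
        FreeQSym.IsInternalSubalgebra (FreeQSym.descentAlgebra B) ∧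
          ∀ n : ℕ, 1 ∈ B n → 1 ∈ FreeQSym.component (FreeQSym.descentAlgebra B) n) ∧
    (∀ (A : Type*) [Ring A] [Algebra K A] [Module.Projective K A],
      FreeQSym.IsInternalSubalgebra (FreeQSym.novelliThibon K A) ∧
        ∀ n : ℕ, 1 ∈ FreeQSym.component (FreeQSym.novelliThibon K A) n) ∧
    (∀ (A : Type*) [Ring A] [Bialgebra K A] [Coalgebra.IsCocomm K A] [Module.Projective K A],
      FreeQSym.IsInternalSubalgebra (FreeQSym.mantaciReutenauer K A) ∧
        ∀ n : ℕ, 1 ∈ FreeQSym.component (FreeQSym.mantaciReutenauer K A) n) := by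
  refine ⟨?_, ?_, ?_⟩
  · intro A _ _ _ B hA hB hC
    exact ⟨FreeQSym.isInternalSubalgebra_of_splitsTwo hA.splitsTwo hB hC,
      fun n hn => FreeQSym.single_one_mem_descentAlgebra hn⟩
  · intro A _ _ _
    exact ⟨FreeQSym.isInternalSubalgebra_of_splitsTwo (FreeQSym.splitsTwo_symTensors A)
      (FreeQSym.conditionB_symTensors A) fun _ => le_rfl,
      fun n => FreeQSym.single_one_mem_descentAlgebra (FreeQSym.one_mem_symTensors A n)⟩
  · intro A _ _ _ _
    exact ⟨FreeQSym.isInternalSubalgebra_of_splitsTwo FreeQSym.splitsTwo_iterComul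
      FreeQSym.conditionB_iterComul FreeQSym.conditionC_iterComul,
      fun n => FreeQSym.single_one_mem_descentAlgebra ⟨1, FreeQSym.iterComul_map_one n⟩⟩
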